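/- \textbf{Theorem (Hamilton variational principle).} Let $Q$ be a second-countable Hausdorff smooth manifold of dimension $n$ without boundary, let $\mathcal L\in C^\infty(TQ)$, let $a<b$, and let $\gamma\colon[a,b]\to Q$ be a curve of class $C^2$, with canonical lift $\widetilde\gamma=(\gamma,\gamma')\colon[a,b]\to TQ$. Let $J$ be the vertical endomorphism of $T(TQ)$ (project by $T\tau_Q$, $\tau_Q\colon TQ\to Q$, then lift vertically) and $\Delta$ the Liouville vector field on $TQ$ (the vertical lift of $v$ at each $(q,v)$). Put $\Theta_{\mathcal L}=d\mathcal L\circ J$, $\Omega_{\mathcal L}=-d\Theta_{\mathcal L}$ and $E_{\mathcal L}=\Delta(\mathcal L)-\mathcal L$. The curve $\gamma$ is called a \emph{local extreme} of the action $\mathbf L(\gamma)=\int_a^b\mathcal L(\widetilde\gamma(t))\,dt$ if, for every smooth vector field $X$ on $Q$ with $X(\gamma(a))=0$ and $X(\gamma(b))=0$, and every smooth local flow $F_s$ of $X$ defined for $|s|<\varepsilon$ on an open neighbourhood of $\gamma([a,b])$, one has $$\frac{d}{ds}\Big|_{s=0}\mathbf L(F_s\circ\gamma)=0 .$$ \begin{enumerate}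 \item The lift $\widetilde\gamma$ satisfies $$i(\widetilde\gamma'(t))\,\Omega_{\mathcal L}=dE_{\mathcal L}\quad\text{at }\widetilde\gamma(t),\ \text{for all } t\in[a,b] \qquad (\ast)$$ if and only if $\gamma$ satisfies the Euler--Lagrange equations $\frac{d}{dt}\frac{\partial\mathcal L}{\partial v^i}(\widetilde\gamma(t))=\frac{\partial\mathcal L}{\partial q^i}(\widetilde\gamma(t))$, $i=1,\dots,n$, in the natural coordinates $(q^i,v^i)$ of $TQ$ induced by every chart of the smooth structure of $Q$, at all times at which $\gamma$ is in the domain of the chart. \item If $(\ast)$ holds, then $\gamma$ is a local extreme of $\mathbf L$. \item Suppose that the set of $t\in[a,b]$ such that $\gamma(s)\ne\gamma(t)$ for all $s\in[a,b]\setminus\{t\}$ is dense in $[a,b]$ (for instance, $\gamma$ is injective, or a simple closed curve, or has only finitely many self-intersections). Then $\gamma$ is a local extreme of $\mathbf L$ if and only if $(\ast)$ holds. \end{enumerate} (Derivatives at $a$ and $b$ are one-sided.) -/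

import Mathlib

open Set Function MeasureTheory
open scoped Manifold ContDiff Topology

noncomputable section

namespace LagrangianMechanics

section Forms

variable {E : Type*} [NormedAddCommGroup E] [NormedSpace ℝ E]
  {H : Type*} [TopologicalSpace H] (I : ModelWithCorners ℝ E H)
  {M : Type*} [TopologicalSpace M] [ChartedSpace H M]

/-- The differential `df` of a real function, as a 1-form. -/
def diff (f : M → ℝ) (p : M) : TangentSpace I p →L[ℝ] ℝ :=
  mfderiv I 𝓘(ℝ, ℝ) f p

/-- The expression of a 1-form `θ` in the chart centred at `p`: its pullback by the inverse of
that chart, a 1-form on the model vector space (for a manifold without boundary). -/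
def formInChart (θ : ∀ p : M, TangentSpace I p →L[ℝ] ℝ) (p : M) (y : E) : E →L[ℝ] ℝ :=
  (θ ((extChartAt I p).symm y)).comp (mfderiv 𝓘(ℝ, E) I (extChartAt I p).symm y)

/-- The exterior derivative of a 1-form on a manifold without boundary, computed at `p` in the
chart centred at `p`: `dθ (X, Y) = ∑ (∂ᵢ θⱼ - ∂ⱼ θᵢ) Xⁱ Yʲ`. -/
def extDerivOneForm (θ : ∀ p : M, TangentSpace I p →L[ℝ] ℝ) (p : M)
    (X Y : TangentSpace I p) : ℝ :=
  let X' : E := mfderiv I 𝓘(ℝ, E) (extChartAt I p) p X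
  let Y' : E := mfderiv I 𝓘(ℝ, E) (extChartAt I p) p Y
  let D : E →L[ℝ] E →L[ℝ] ℝ := fderiv ℝ (formInChart I θ p) (extChartAt I p p)
  D X' Y' - D Y' X'

end Forms

section Lagrangian

variable {n : ℕ} {Q : Type*} [TopologicalSpace Q] [ChartedSpace (EuclideanSpace ℝ (Fin n)) Q]
  [IsManifold (𝓡 n) ∞ Q]

/-- The vertical lift `T_q Q → T_{(q,u)} TQ` at `p = (q, u)`: the tangent map at `u` of the
inclusion of the fibre `T_q Q` (whose underlying vector space is `ℝⁿ`) into `TQ`. -/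
def verticalLift (p : TangentBundle (𝓡 n) Q) :
    TangentSpace (𝓡 n) p.proj →L[ℝ] TangentSpace (𝓡 n).tangent p :=
  mfderiv 𝓘(ℝ, EuclideanSpace ℝ (Fin n)) (𝓡 n).tangent
    (fun w : EuclideanSpace ℝ (Fin n) => (⟨p.proj, w⟩ : TangentBundle (𝓡 n) Q)) p.snd

/-- The vertical endomorphism `J` of `T(TQ)`: project to `TQ`, then lift vertically. -/
def verticalEndomorphism (p : TangentBundle (𝓡 n) Q) :
    TangentSpace (𝓡 n).tangent p →L[ℝ] TangentSpace (𝓡 n).tangent p :=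
  (verticalLift p).comp
    (mfderiv (𝓡 n).tangent (𝓡 n) (fun x : TangentBundle (𝓡 n) Q => x.proj) p)

/-- The Liouville vector field `Δ` on `TQ`. -/
def liouville (p : TangentBundle (𝓡 n) Q) : TangentSpace (𝓡 n).tangent p :=
  verticalLift p p.snd

/-- The Cartan 1-form `Θ_L = dL ∘ J`. -/
def cartanOneForm (L : TangentBundle (𝓡 n) Q → ℝ) (p : TangentBundle (𝓡 n) Q) :
    TangentSpace (𝓡 n).tangent p →L[ℝ] ℝ :=
  (diff (𝓡 n).tangent L p).comp (verticalEndomorphism p)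

/-- The Cartan 2-form `Ω_L = - dΘ_L`. -/
def cartanTwoForm (L : TangentBundle (𝓡 n) Q → ℝ) (p : TangentBundle (𝓡 n) Q)
    (X Y : TangentSpace (𝓡 n).tangent p) : ℝ :=
  - extDerivOneForm (𝓡 n).tangent (cartanOneForm L) p X Y

/-- The Lagrangian energy `E_L = Δ(L) - L`. -/
def energy (L : TangentBundle (𝓡 n) Q → ℝ) (p : TangentBundle (𝓡 n) Q) : ℝ :=
  diff (𝓡 n).tangent L p (liouville p) - L p

/-- The canonical lift `t ↦ (γ t, γ' t)` to `TQ` of a curve `γ : [a, b] → Q`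
(one-sided derivatives at the end points). -/
def canonicalLift (a b : ℝ) (γ : ℝ → Q) (t : ℝ) : TangentBundle (𝓡 n) Q :=
  ⟨γ t, mfderivWithin 𝓘(ℝ, ℝ) (𝓡 n) γ (Icc a b) t (1 : ℝ)⟩

/-- The velocity of the canonical lift, a tangent vector to `TQ`. -/
def canonicalLiftVelocity (a b : ℝ) (γ : ℝ → Q) (t : ℝ) :
    TangentSpace (𝓡 n).tangent (canonicalLift (n := n) a b γ t) :=
  mfderivWithin 𝓘(ℝ, ℝ) (𝓡 n).tangent (canonicalLift (n := n) a b γ) (Icc a b) t (1 : ℝ)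

/-- The action `∫_a^b L(γ, γ') dt`. -/
def action (L : TangentBundle (𝓡 n) Q → ℝ) (a b : ℝ) (γ : ℝ → Q) : ℝ :=
  ∫ t in a..b, L (canonicalLift a b γ t)

/-- `F` is a smooth local flow of `X`, defined on `(-ε, ε) × U`. -/
structure IsLocalFlow (X : ∀ q : Q, TangentSpace (𝓡 n) q) (ε : ℝ) (U : Set Q)
    (F : ℝ → Q → Q) : Prop where
  pos : 0 < ε
  isOpen : IsOpen U
  zero : ∀ q ∈ U, F 0 q = q
  integral : ∀ q ∈ U, IsMIntegralCurveOn (I := 𝓡 n) (fun s => F s q) X (Ioo (-ε) ε)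
  smooth : ContMDiffOn (𝓘(ℝ, ℝ).prod (𝓡 n)) (𝓡 n) ∞ (uncurry F) (Ioo (-ε) ε ×ˢ U)

/-- `γ : [a, b] → Q` is a local extreme of the action of `L`: for every smooth vector field `X`
on `Q` vanishing at `γ a` and `γ b`, and every local flow `F` of `X` defined around the image of
`γ`, the derivative at `s = 0` of the action of `F s ∘ γ` is zero. -/
def IsLocalExtreme (L : TangentBundle (𝓡 n) Q → ℝ) (a b : ℝ) (γ : ℝ → Q) : Prop :=
  ∀ X : ∀ q : Q, TangentSpace (𝓡 n) q,
    ContMDiff (𝓡 n) (𝓡 n).tangent ∞ (fun q => (⟨q, X q⟩ : TangentBundle (𝓡 n) Q)) →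
    X (γ a) = 0 → X (γ b) = 0 →
    ∀ (ε : ℝ) (U : Set Q) (F : ℝ → Q → Q), IsLocalFlow X ε U F → γ '' Icc a b ⊆ U →
      HasDerivAt (fun s => action L a b (fun t => F s (γ t))) 0 0

/-- `i(γ̃') Ω_L = dE_L` along the canonical lift `γ̃` of `γ`. -/
def SatisfiesLagrangeEquation (L : TangentBundle (𝓡 n) Q → ℝ) (a b : ℝ) (γ : ℝ → Q) : Prop :=
  ∀ t ∈ Icc a b, ∀ Y : TangentSpace (𝓡 n).tangent (canonicalLift (n := n) a b γ t),
    cartanTwoForm L (canonicalLift a b γ t) (canonicalLiftVelocity a b γ t) Y =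
      diff (𝓡 n).tangent (energy L) (canonicalLift a b γ t) Y

/-- The Lagrangian `L` in the natural coordinates `(x, v)` of `TQ` induced by a chart `e`
of `Q`. -/
def lagrangianInChart (L : TangentBundle (𝓡 n) Q → ℝ)
    (e : OpenPartialHomeomorph Q (EuclideanSpace ℝ (Fin n)))
    (x v : EuclideanSpace ℝ (Fin n)) : ℝ :=
  L ⟨e.symm x, mfderiv 𝓘(ℝ, EuclideanSpace ℝ (Fin n)) (𝓡 n) e.symm x v⟩

/-- The Euler–Lagrange equations `d/dt (∂L/∂v) = ∂L/∂x` in all natural coordinates of `TQ`,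
at all times when `γ` is in the domain of the chart; contracted with an arbitrary `w ∈ ℝⁿ`. -/
def SatisfiesEulerLagrange (L : TangentBundle (𝓡 n) Q → ℝ) (a b : ℝ) (γ : ℝ → Q) : Prop :=
  ∀ e ∈ IsManifold.maximalAtlas (𝓡 n) ∞ Q, ∀ t ∈ Icc a b, γ t ∈ e.source →
    ∀ w : EuclideanSpace ℝ (Fin n),
      let x : ℝ → EuclideanSpace ℝ (Fin n) := fun s => e (γ s)
      let v : ℝ → EuclideanSpace ℝ (Fin n) := fun s => derivWithin x (Icc a b) s
      HasDerivWithinAt (fun s => fderiv ℝ (fun u => lagrangianInChart L e (x s) u) (v s) w)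
        (fderiv ℝ (fun y => lagrangianInChart L e y (v t)) (x t) w) (Icc a b) t

/-- The times at which `γ : [a, b] → Q` passes through a point that it visits only once are
dense in `[a, b]`. -/
def HasDenseSimpleTimes (a b : ℝ) (γ : ℝ → Q) : Prop :=
  Icc a b ⊆ closure {t | t ∈ Icc a b ∧ ∀ s ∈ Icc a b, γ s = γ t → s = t}

end Lagrangian

end LagrangianMechanics

end

/-!
Everything rests on a pointwise first variation formula. Let `F s` be a variation of the identity
of `Q` with velocity field `X`, and let `R(t)` be the Euler–Lagrange covector
`∂L/∂x - d/dt ∂L/∂v` of `γ` in a chart `e` around `γ t`. Then the derivative at `s = 0` of `L` along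
the canonical lift of `F s ∘ γ` is, at the time `t`,

  `R(t) · X(γ t) + d/dt (∂L/∂v · X)`

(`hasDerivAt_liftedVariation`). The momentum `∂L/∂v · X` is a function of time defined without a
chart (`momentumPairing`), and so is the left-hand side. Hence `R(t) · X(γ t)` does not depend on
the chart; applied to the translations of a chart, this shows that the Euler–Lagrange equations in
one chart imply those in any other (`eulerLagrangeResidual_eq_zero_of_chart`).

*The geometric equation.* In natural coordinates `Θ_L = (∂L/∂v) dx` and `E_L = (∂L/∂v) v - L`. The
lift of a curve is a second-order curve, so its velocity has position component `v`, and evaluating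
`i(γ̃') Ω_L - dE_L` on a tangent vector `Y` of `TQ` gives `R(t)` on the position component of `Y`
(`lagrangeEquation_iff`). Together with chart independence this is the equivalence with the
Euler–Lagrange equations.

*Solutions are extremes.* One may differentiate the action under the integral sign
(`hasDerivAt_action`). If `X` vanishes at both ends, the total derivative integrates to zero, and
the derivative of the action is the integral of `R(t) · X(γ t)` (`integral_deriv_liftedVariation`),
which vanishes for solutions.

*Extremes are solutions.* If `R(t₀) · w > 0`, then by continuity and density `R(t) · w > 0` near a
time `t₁` in the open interval whose point is visited only once. By compactness a small ball around
`γ t₁` in the chart is visited only at times near `t₁`. A bump function on this ball times the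
constant field `w` is a smooth vector field on `Q` for which the derivative of the action is
positive (`eulerLagrangeResidual_nonpos_of_isLocalExtreme`).

The definition of an extreme only speaks of fields along with a smooth local flow, so the flow of
this field has to be exhibited (`exists_vectorField_isLocalFlow`). For a compactly supported field
`ξ` on the model space (`exists_smooth_flow`), the flow at time `s` is the value at `1` of the
solution of `w(τ) = x + s ∫₀^τ ξ(w)` in the Banach space of continuous paths on `[-1, 1]`. This is
a fixed point equation for a contraction when `s` is small, and it depends smoothly on `(s, x, w)`
because superposition with a smooth map is a smooth operator on continuous paths
(`ContinuousMap.contDiff_postcomp`); the implicit function theorem then gives the joint smoothness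
of the flow.
-/

noncomputable section

/-! ### Superposition operators on spaces of continuous maps -/

section SuperpositionOperator

universe u

variable {K : Type*} [TopologicalSpace K] [CompactSpace K]

/-- The bilinear map `C(K, G) × C(K, E) → C(K, F)` that applies a continuous bilinear map
`B : G × E → F` pointwise, as a bounded bilinear map. -/
def ContinuousMap.bilinearL (K : Type*) [TopologicalSpace K] [CompactSpace K]
    {E F G : Type*} [NormedAddCommGroup E] [NormedSpace ℝ E] [NormedAddCommGroup F]
    [NormedSpace ℝ F] [NormedAddCommGroup G] [NormedSpace ℝ G] (B : G →L[ℝ] E →L[ℝ] F) :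
    C(K, G) →L[ℝ] C(K, E) →L[ℝ] C(K, F) :=
  LinearMap.mkContinuous₂
    (LinearMap.mk₂ ℝ
      (fun (A : C(K, G)) (v : C(K, E)) =>
        (⟨fun k => B (A k) (v k), (B.continuous.comp A.continuous).clm_apply v.continuous⟩ :
          C(K, F)))
      (fun _ _ _ => by ext; simp) (fun _ _ _ => by ext; simp)
      (fun _ _ _ => by ext; simp) (fun _ _ _ => by ext; simp)) ‖B‖
    (fun A v => by
      rw [ContinuousMap.norm_le _ (by positivity)]
      intro k
      refine (B.le_opNorm₂ (A k) (v k)).trans ?_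
      gcongr
      exacts [A.norm_coe_le_norm k, v.norm_coe_le_norm k])

@[simp] theorem ContinuousMap.bilinearL_apply {E F G : Type*} [NormedAddCommGroup E]
    [NormedSpace ℝ E] [NormedAddCommGroup F] [NormedSpace ℝ F] [NormedAddCommGroup G]
    [NormedSpace ℝ G] (B : G →L[ℝ] E →L[ℝ] F) (A : C(K, G)) (v : C(K, E)) (k : K) :
    ContinuousMap.bilinearL K B A v k = B (A k) (v k) := rfl

/-- The superposition operator `w ↦ f ∘ w` of a `C¹` map `f` is differentiable on spaces of
continuous functions. The derivative of `f` is given as `B ∘ g`, with a fixed bilinear map `B`, so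
that the derivative of the operator is a bounded linear map applied to the superposition operator
of `g`; this is what makes the induction on the order of differentiability work. -/
theorem ContinuousMap.hasFDerivAt_postcomp {E F G : Type*} [NormedAddCommGroup E]
    [NormedSpace ℝ E] [NormedAddCommGroup F] [NormedSpace ℝ F] [NormedAddCommGroup G]
    [NormedSpace ℝ G] (B : G →L[ℝ] E →L[ℝ] F) (f : C(E, F)) (g : C(E, G))
    (h : ∀ x, HasFDerivAt f (B (g x)) x) (w : C(K, E)) :
    HasFDerivAt (fun w : C(K, E) => f.comp w) (ContinuousMap.bilinearL K B (g.comp w)) w := by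
  rw [hasFDerivAt_iff_isLittleO, Asymptotics.isLittleO_iff]
  intro c hc
  have hcont : Continuous fun w : C(K, E) => g.comp w := ContinuousMap.continuous_postcomp _
  have hc' : 0 < c / (‖B‖ + 1) := by positivity
  obtain ⟨δ, hδ, hball⟩ := Metric.continuous_iff.1 hcont w _ hc'
  filter_upwards [Metric.ball_mem_nhds w hδ] with z hz
  rw [ContinuousMap.norm_le _ (by positivity)]
  -- the mean value inequality at each `k`, with a bound on the derivative uniform in `k`
  intro k
  have hzk : ‖z k - w k‖ ≤ ‖z - w‖ := (z - w).norm_coe_le_norm k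
  have hz' : ‖z - w‖ < δ := by simpa [dist_eq_norm] using hz
  have key := (convex_ball (w k) δ).norm_image_sub_le_of_norm_hasFDerivWithin_le'
    (f := f) (f' := fun x => B (g x)) (φ := B (g (w k))) (C := c) (x := w k) (y := z k)
    (fun x _ => (h x).hasFDerivWithinAt)
    (fun x hx => by
      -- compare `w` with its translate by the constant function `x - w k`
      have h1 := hball (w + ContinuousMap.const K (x - w k)) (by
        rw [dist_eq_norm, add_sub_cancel_left]
        refine lt_of_le_of_lt ((ContinuousMap.norm_le _ (norm_nonneg (x - w k))).2 (by simp)) ?_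
        simpa [dist_eq_norm] using hx)
      have h2 := (ContinuousMap.dist_apply_le_dist (f := g.comp
        (w + ContinuousMap.const K (x - w k))) k).trans h1.le
      have h3 : ‖g x - g (w k)‖ ≤ c / (‖B‖ + 1) := by simpa [dist_eq_norm] using h2
      rw [← map_sub]
      refine (B.le_opNorm _).trans ?_
      calc ‖B‖ * ‖g x - g (w k)‖ ≤ (‖B‖ + 1) * (c / (‖B‖ + 1)) := by gcongr; linarith
        _ = c := by field_simp)
    (Metric.mem_ball_self hδ) (by
      rw [Metric.mem_ball, dist_eq_norm]
      exact hzk.trans_lt hz')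
  refine le_trans ?_ (key.trans (mul_le_mul_of_nonneg_left hzk hc.le))
  simp

/-- If the derivative of `f` is represented by `g`, the superposition operator of `f` has one more
derivative than that of `g`. -/
theorem ContinuousMap.contDiff_succ_postcomp {E F G : Type*} [NormedAddCommGroup E]
    [NormedSpace ℝ E] [NormedAddCommGroup F] [NormedSpace ℝ F] [NormedAddCommGroup G]
    [NormedSpace ℝ G] (B : G →L[ℝ] E →L[ℝ] F) (f : C(E, F)) (g : C(E, G))
    (h : ∀ x, HasFDerivAt f (B (g x)) x) {m : ℕ}
    (hg : ContDiff ℝ m fun w : C(K, E) => g.comp w) :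
    ContDiff ℝ ((m : WithTop ℕ∞) + 1) fun w : C(K, E) => f.comp w :=
  contDiff_succ_iff_hasFDerivAt.2 ⟨_, (ContinuousMap.bilinearL K B).contDiff.comp hg,
    fun w => ContinuousMap.hasFDerivAt_postcomp B f g h w⟩

/-- The superposition operator of a `C^m` map is `C^m` on spaces of continuous functions. -/
theorem ContinuousMap.contDiff_postcomp_nat (m : ℕ) :
    ∀ {E F : Type u} [NormedAddCommGroup E] [NormedSpace ℝ E] [NormedAddCommGroup F]
      [NormedSpace ℝ F] (f : C(E, F)) (_ : ContDiff ℝ m f),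
      ContDiff ℝ m (fun w : C(K, E) => f.comp w) := by
  induction m with
  | zero =>
    intro E F _ _ _ _ f hf
    exact contDiff_zero.2 (ContinuousMap.continuous_postcomp _)
  | succ m ih =>
    intro E F _ _ _ _ f hf
    have hf2 : ContDiff ℝ ((m : WithTop ℕ∞) + 1) f := by exact_mod_cast hf
    obtain ⟨f', hf', hd⟩ := contDiff_succ_iff_hasFDerivAt.1 hf2
    have := ContinuousMap.contDiff_succ_postcomp (K := K) (ContinuousLinearMap.id ℝ (E →L[ℝ] F)) f
      ⟨f', hf'.continuous⟩ hd (ih _ hf')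
    exact_mod_cast this

theorem ContinuousMap.contDiff_postcomp {E F : Type u} [NormedAddCommGroup E] [NormedSpace ℝ E]
    [NormedAddCommGroup F] [NormedSpace ℝ F] (f : C(E, F)) (hf : ContDiff ℝ ∞ f) :
    ContDiff ℝ ∞ (fun w : C(K, E) => f.comp w) :=
  contDiff_infty.2 fun m => ContinuousMap.contDiff_postcomp_nat m f (contDiff_infty.1 hf m)

end SuperpositionOperator

/-! ### Smooth flows of globally Lipschitz vector fields -/

section SmoothFlow

universe u

variable {E : Type u} [NormedAddCommGroup E] [NormedSpace ℝ E]

theorem ContinuousLinearMap.isInvertible_one_sub {V : Type*} [NormedAddCommGroup V]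
    [NormedSpace ℝ V] [CompleteSpace V] {T : V →L[ℝ] V} (hT : ‖T‖ < 1) :
    (1 - T).IsInvertible :=
  ⟨ContinuousLinearEquiv.unitsEquiv ℝ V (Units.oneSub T hT), by ext; rfl⟩

/-- The space of continuous `E`-valued paths on `[-1, 1]`. A fixed interval is used for all flow
times: the flow at time `s` is the value at `1` of the integral curve of `s ξ`. -/
abbrev PathSpace (E : Type*) [TopologicalSpace E] := C(Icc (-1 : ℝ) 1, E)

/-- The continuous extension of a path on `[-1, 1]` to the real line, constant on both sides. -/
def PathSpace.extend {E : Type*} [TopologicalSpace E] (w : PathSpace E) : ℝ → E :=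
  IccExtend (by norm_num : (-1 : ℝ) ≤ 1) w

theorem PathSpace.continuous_extend {E : Type*} [TopologicalSpace E] (w : PathSpace E) :
    Continuous w.extend := w.continuous.Icc_extend'

theorem PathSpace.extend_of_mem {E : Type*} [TopologicalSpace E] (w : PathSpace E) {t : ℝ}
    (ht : t ∈ Icc (-1 : ℝ) 1) : w.extend t = w ⟨t, ht⟩ := IccExtend_of_mem _ _ ht

theorem PathSpace.norm_extend_le {E : Type*} [NormedAddCommGroup E] (w : PathSpace E) (t : ℝ) :
    ‖w.extend t‖ ≤ ‖w‖ :=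
  w.norm_coe_le_norm _

/-- The Volterra operator `w ↦ ∫₀^τ w`. -/
def volterraL (E : Type*) [NormedAddCommGroup E] [NormedSpace ℝ E] :
    PathSpace E →L[ℝ] PathSpace E :=
  LinearMap.mkContinuous
    { toFun := fun w =>
        ⟨fun τ => ∫ r in (0 : ℝ)..τ, w.extend r,
          (intervalIntegral.continuous_primitive
            (fun _ _ => w.continuous_extend.intervalIntegrable _ _) 0).comp continuous_subtype_val⟩
      map_add' := fun v w => by
        ext τ
        exact intervalIntegral.integral_add (v.continuous_extend.intervalIntegrable _ _)
          (w.continuous_extend.intervalIntegrable _ _)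
      map_smul' := fun c w => by
        ext τ
        exact intervalIntegral.integral_smul c _ } 1
    (fun w => by
      rw [ContinuousMap.norm_le _ (by positivity)]
      intro τ
      refine (intervalIntegral.norm_integral_le_of_norm_le_const
        fun r _ => w.norm_extend_le r).trans ?_
      rw [one_mul, sub_zero]
      exact mul_le_of_le_one_right (norm_nonneg w) (abs_le.2 τ.2))

theorem norm_volterraL_le (w : PathSpace E) : ‖volterraL E w‖ ≤ ‖w‖ := by
  have := (volterraL E).le_of_opNorm_le (LinearMap.mkContinuous_norm_le _ zero_le_one _) w
  simpa using this

/-- The nonlinear part `w ↦ s ∫₀^τ ξ(w)` of the integral equation of the field `s ξ`. -/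
def integralOperator (ξ : C(E, E)) (s : ℝ) (w : PathSpace E) : PathSpace E :=
  s • volterraL E (ξ.comp w)

theorem dist_integralOperator_le {ξ : C(E, E)} {κ : NNReal} (hξ : LipschitzWith κ ξ) (s : ℝ)
    (v w : PathSpace E) :
    dist (integralOperator ξ s v) (integralOperator ξ s w) ≤ |s| * κ * dist v w := by
  rw [integralOperator, integralOperator, dist_eq_norm, ← smul_sub, ← map_sub, norm_smul, mul_assoc,
    Real.norm_eq_abs]
  refine mul_le_mul_of_nonneg_left ((norm_volterraL_le _).trans ?_) (abs_nonneg s)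
  rw [← dist_eq_norm, ContinuousMap.dist_le (by positivity)]
  intro τ
  exact (hξ.dist_le_mul _ _).trans (by gcongr; exact ContinuousMap.dist_apply_le_dist τ)

theorem lipschitzWith_integralOperator {ξ : C(E, E)} {κ : NNReal} (hξ : LipschitzWith κ ξ)
    (s : ℝ) : LipschitzWith (‖s‖₊ * κ) (integralOperator ξ s) :=
  LipschitzWith.of_dist_le_mul fun v w => dist_integralOperator_le hξ s v w

/-- For small `s`, the integral equation `w = x + s ∫₀^τ ξ(w)` has exactly one solution. -/
theorem existsUnique_integralEquation [CompleteSpace E] {ξ : C(E, E)} {κ : NNReal}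
    (hξ : LipschitzWith κ ξ) {s : ℝ} (hs : |s| * κ < 1) (x : E) :
    ∃! w : PathSpace E, w = ContinuousMap.const _ x + integralOperator ξ s w := by
  have hc : ContractingWith (‖s‖₊ * κ)
      (fun w : PathSpace E => ContinuousMap.const _ x + integralOperator ξ s w) := by
    refine ⟨by rw [← NNReal.coe_lt_coe]; simpa using hs, LipschitzWith.of_dist_le_mul ?_⟩
    intro v w
    rw [dist_add_left]
    exact dist_integralOperator_le hξ s v w
  refine ⟨hc.fixedPoint, hc.fixedPoint_isFixedPt.symm, fun v hv => ?_⟩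
  exact hc.fixedPoint_unique (show _ = _ from hv.symm)

theorem contDiff_integralOperator {ξ : C(E, E)} (hξ : ContDiff ℝ ∞ ξ) :
    ContDiff ℝ ∞ fun p : ℝ × PathSpace E => integralOperator ξ p.1 p.2 :=
  contDiff_fst.smul
    ((volterraL E).contDiff.comp ((ContinuousMap.contDiff_postcomp ξ hξ).comp contDiff_snd))

/-- The constant paths, as a continuous linear map. -/
def PathSpace.constL (E : Type*) [NormedAddCommGroup E] [NormedSpace ℝ E] :
    E →L[ℝ] PathSpace E :=
  LinearMap.mkContinuous
    { toFun := fun x => ContinuousMap.const _ x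
      map_add' := fun _ _ => rfl
      map_smul' := fun _ _ => rfl } 1
    (fun x => by
      rw [ContinuousMap.norm_le _ (by positivity)]
      exact fun _ => (one_mul ‖x‖).ge)

/-- Evaluation of paths at a time, as a continuous linear map. -/
def PathSpace.evalL (E : Type*) [NormedAddCommGroup E] [NormedSpace ℝ E] (τ : Icc (-1 : ℝ) 1) :
    PathSpace E →L[ℝ] E :=
  LinearMap.mkContinuous
    { toFun := fun w => w τ
      map_add' := fun _ _ => rfl
      map_smul' := fun _ _ => rfl } 1
    (fun w => by
      rw [one_mul]
      exact w.norm_coe_le_norm τ)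

/-- By the implicit function theorem, the solutions of the integral equation depend smoothly on
the parameter `s` and the initial point. -/
theorem contDiffAt_integralEquation [CompleteSpace E] {ξ : C(E, E)} {κ : NNReal}
    (hξ : LipschitzWith κ ξ) (hs : ContDiff ℝ ∞ ξ) (w : ℝ → E → PathSpace E)
    (hw : ∀ (s : ℝ) (x : E), |s| * κ < 1 →
      w s x = ContinuousMap.const _ x + integralOperator ξ s (w s x))
    {s : ℝ} (hsκ : |s| * κ < 1) (x : E) : ContDiffAt ℝ ∞ (uncurry w) (s, x) := by
  -- the solutions are the zeros of `Ψ`, whose partial derivative in the path is `1 - D` with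
  -- `‖D‖ ≤ |s| κ < 1`
  let Ψ : (ℝ × E) × PathSpace E → PathSpace E := fun p =>
    p.2 - (PathSpace.constL E p.1.2 + integralOperator ξ p.1.1 p.2)
  have hΨ : ContDiff ℝ ∞ Ψ := by
    refine contDiff_snd.sub (((PathSpace.constL E).contDiff.comp
      (contDiff_snd.comp contDiff_fst)).add ?_)
    exact (contDiff_integralOperator hs).comp
      ((contDiff_fst.comp contDiff_fst).prodMk contDiff_snd)
  set u : (ℝ × E) × PathSpace E := ((s, x), w s x)
  have hzero : Ψ u = 0 := sub_eq_zero.2 (hw s x hsκ)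
  have hdiff : DifferentiableAt ℝ Ψ u := hΨ.differentiable (by simp) u
  have hWd : DifferentiableAt ℝ (integralOperator ξ s) (w s x) :=
    (((contDiff_integralOperator hs).comp (contDiff_const.prodMk contDiff_id)).differentiable
      (by simp) (w s x) :)
  have hpart : fderiv ℝ Ψ u ∘L .inr ℝ (ℝ × E) (PathSpace E) =
      1 - fderiv ℝ (integralOperator ξ s) (w s x) := by
    have h1 : HasFDerivAt (fun v : PathSpace E => Ψ ((s, x), v))
        (fderiv ℝ Ψ u ∘L .inr ℝ (ℝ × E) (PathSpace E)) (w s x) :=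
      HasFDerivAt.comp (w s x) (g := Ψ) hdiff.hasFDerivAt (hasFDerivAt_prodMk_right (s, x) (w s x))
    have h2 : HasFDerivAt (fun v : PathSpace E => Ψ ((s, x), v))
        (1 - fderiv ℝ (integralOperator ξ s) (w s x)) (w s x) :=
      (hasFDerivAt_id (w s x)).fun_sub (hWd.hasFDerivAt.const_add (PathSpace.constL E x))
    exact h1.unique h2
  have hinv : (fderiv ℝ Ψ u ∘L .inr ℝ (ℝ × E) (PathSpace E)).IsInvertible := by
    rw [hpart]
    have hnorm : ‖fderiv ℝ (integralOperator ξ s) (w s x)‖ < 1 :=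
      (norm_fderiv_le_of_lipschitz ℝ (lipschitzWith_integralOperator hξ s)).trans_lt (by simpa)
    exact ContinuousLinearMap.isInvertible_one_sub hnorm
  have hΨu : ContDiffAt ℝ ∞ Ψ u := hΨ.contDiffAt
  have himp := hΨu.contDiffAt_implicitFunction (by simp) hinv
  refine himp.congr_of_eventuallyEq ?_
  have hopen : ∀ᶠ p : ℝ × E in 𝓝 (s, x), |p.1| * κ < 1 :=
    (by fun_prop : Continuous fun p : ℝ × E => |p.1| * (κ : ℝ)).continuousAt.eventually_lt
      continuousAt_const hsκ
  filter_upwards [hopen, hΨu.eventually_apply_implicitFunction (by simp) hinv] with p hp hp'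
  rw [hzero] at hp'
  exact (existsUnique_integralEquation hξ hp p.2).unique (hw p.1 p.2 hp) (sub_eq_zero.1 hp')

/-- Rescaling of time: the integral curve of `(c s) ξ` at time `1` is the integral curve of `s ξ` at
time `c`, since `τ ↦ w s x (c τ)` solves the integral equation of `(c s) ξ`. -/
theorem integralEquation_rescale [CompleteSpace E] {ξ : C(E, E)} {κ : NNReal}
    (hξ : LipschitzWith κ ξ) (w : ℝ → E → PathSpace E)
    (hw : ∀ (s : ℝ) (x : E), |s| * κ < 1 →
      w s x = ContinuousMap.const _ x + integralOperator ξ s (w s x))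
    {s : ℝ} (hs : |s| * κ < 1) (x : E) {c : ℝ} (hc : c ∈ Icc (-1 : ℝ) 1) :
    w (c * s) x ⟨1, by norm_num⟩ = w s x ⟨c, hc⟩ := by
  have hmem : ∀ τ : Icc (-1 : ℝ) 1, c * τ ∈ Icc (-1 : ℝ) 1 := fun τ => abs_le.1 <| by
    rw [abs_mul]
    exact mul_le_one₀ (abs_le.2 hc) (abs_nonneg _) (abs_le.2 τ.2)
  let v : PathSpace E := ⟨fun τ => w s x ⟨c * τ, hmem τ⟩, by fun_prop⟩
  have hcs : |c * s| * κ < 1 := by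
    refine lt_of_le_of_lt ?_ hs
    rw [abs_mul]
    have := abs_le.2 hc
    gcongr
    exact mul_le_of_le_one_left (abs_nonneg s) this
  have hv : v = ContinuousMap.const _ x + integralOperator ξ (c * s) v := by
    ext τ
    have h1 := DFunLike.congr_fun (hw s x hs) ⟨c * τ, hmem τ⟩
    have h2 : ∫ r in (0 : ℝ)..τ, PathSpace.extend (ξ.comp v) r =
        ∫ r in (0 : ℝ)..τ, (PathSpace.extend (ξ.comp (w s x))) (c * r) := by
      refine intervalIntegral.integral_congr fun r hr => ?_
      have hr' : r ∈ Icc (-1 : ℝ) 1 := by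
        have h0 : (0 : ℝ) ∈ Icc (-1 : ℝ) 1 := by norm_num
        exact ordConnected_Icc.uIcc_subset h0 τ.2 hr
      rw [PathSpace.extend_of_mem _ hr', PathSpace.extend_of_mem _ (hmem ⟨r, hr'⟩)]
      rfl
    have h3 := intervalIntegral.smul_integral_comp_mul_left (a := 0) (b := (τ : ℝ))
      (PathSpace.extend (ξ.comp (w s x))) c
    rw [mul_zero] at h3
    change w s x ⟨c * τ, hmem τ⟩ = x + (c * s) • ∫ r in (0 : ℝ)..τ, PathSpace.extend (ξ.comp v) r
    rw [h2, mul_comm c s, mul_smul, h3]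
    exact h1
  have := (existsUnique_integralEquation hξ hcs x).unique (hw (c * s) x hcs) hv
  rw [this]
  simp [v]

/-- A smooth Lipschitz vector field on a Banach space has a smooth flow, defined on the whole space
for small times. It is smooth jointly in time and the initial point because time enters the
integral equation as a parameter. -/
theorem exists_smooth_flow [CompleteSpace E] {ξ : E → E} {κ : NNReal}
    (hξ : LipschitzWith κ ξ) (hs : ContDiff ℝ ∞ ξ) :
    ∃ ε > 0, ∃ f : ℝ → E → E, (∀ x, f 0 x = x) ∧
      (∀ x, ∀ s ∈ Ioo (-ε) ε, HasDerivAt (fun s => f s x) (ξ (f s x)) s) ∧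
      ContDiffOn ℝ ∞ (uncurry f) (Ioo (-ε) ε ×ˢ univ) := by
  let ξ' : C(E, E) := ⟨ξ, hs.continuous⟩
  have hξ' : LipschitzWith κ ξ' := hξ
  have hex : ∀ (s : ℝ) (x : E), ∃ w : PathSpace E,
      |s| * κ < 1 → w = ContinuousMap.const _ x + integralOperator ξ' s w := fun s x => by
    by_cases h : |s| * κ < 1
    · obtain ⟨w, hw, -⟩ := existsUnique_integralEquation hξ' h x
      exact ⟨w, fun _ => hw⟩
    · exact ⟨0, fun h' => absurd h' h⟩
  choose w hw using hex
  have hε : 0 < 1 / ((κ : ℝ) + 1) := by positivity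
  have hsmall : ∀ s ∈ Ioo (-(1 / ((κ : ℝ) + 1))) (1 / ((κ : ℝ) + 1)), |s| * κ < 1 := by
    intro s hs'
    have h1 : |s| < 1 / ((κ : ℝ) + 1) := abs_lt.2 hs'
    rw [lt_div_iff₀ (by positivity)] at h1
    nlinarith [abs_nonneg s]
  refine ⟨1 / ((κ : ℝ) + 1), hε, fun s x => w s x ⟨1, by norm_num⟩, ?_, ?_, ?_⟩
  · intro x
    have := DFunLike.congr_fun (hw 0 x (by simp)) ⟨1, by norm_num⟩
    simpa [integralOperator] using this
  · intro x s hs'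
    set ε := 1 / ((κ : ℝ) + 1)
    have hsε : |s| < ε := abs_lt.2 hs'
    -- near `s`, all flow times are read off the single integral curve of `S ξ`
    obtain ⟨S, hS1, hS2⟩ := exists_between hsε
    have hSpos : 0 < S := (abs_nonneg s).trans_lt hS1
    have hS : |S| * κ < 1 := hsmall S ⟨by linarith, hS2⟩
    have hmem : ∀ σ : ℝ, |σ| < S → σ / S ∈ Icc (-1 : ℝ) 1 := fun σ hσ => abs_le.1 <| by
      rw [abs_div, abs_of_pos hSpos]
      exact (div_le_one hSpos).2 hσ.le
    have hval : ∀ σ (hσ : |σ| < S), w σ x ⟨1, by norm_num⟩ = w S x ⟨σ / S, hmem σ hσ⟩ := by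
      intro σ hσ
      have := integralEquation_rescale hξ' w hw hS x (hmem σ hσ)
      rwa [div_mul_cancel₀ σ hSpos.ne'] at this
    have hder : HasDerivAt
        (fun σ : ℝ => x + S • ∫ r in (0 : ℝ)..(σ / S), (PathSpace.extend (ξ'.comp (w S x))) r)
        (ξ (w s x ⟨1, by norm_num⟩)) s := by
      have h1 : HasDerivAt (fun τ : ℝ => ∫ r in (0 : ℝ)..τ, (PathSpace.extend (ξ'.comp (w S x))) r)
          ((PathSpace.extend (ξ'.comp (w S x))) (s / S)) (s / S) :=
        (PathSpace.continuous_extend _).integral_hasStrictDerivAt 0 (s / S) |>.hasDerivAt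
      have h2 : HasDerivAt (fun σ : ℝ => σ / S) (1 / S) s := (hasDerivAt_id s).div_const S
      have h3 := ((h1.scomp s h2).const_smul S).const_add x
      refine h3.congr_deriv ?_
      rw [smul_smul, mul_one_div_cancel hSpos.ne', one_smul,
        PathSpace.extend_of_mem _ (hmem s hS1), hval s hS1]
      rfl
    refine hder.congr_of_eventuallyEq ?_
    have : ∀ᶠ σ : ℝ in 𝓝 s, |σ| < S := continuous_abs.continuousAt.eventually_lt
      continuousAt_const hS1
    filter_upwards [this] with σ hσ
    rw [hval σ hσ]
    exact DFunLike.congr_fun (hw S x hS) ⟨σ / S, hmem σ hσ⟩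
  · rintro ⟨s, x⟩ ⟨hs', -⟩
    have h1 := contDiffAt_integralEquation hξ' hs w hw (hsmall s hs') x
    have h2 : ContDiffAt ℝ ∞ (fun p : ℝ × E => uncurry w p ⟨1, by norm_num⟩) (s, x) :=
      (PathSpace.evalL E ⟨1, by norm_num⟩).contDiff.contDiffAt.comp _ h1
    exact h2.contDiffWithinAt

end SmoothFlow

set_option linter.unusedSectionVars false

namespace LagrangianMechanics

local notation "𝔼(" n ")" => EuclideanSpace ℝ (Fin n)

/-! ### Natural coordinates on the tangent bundle -/

section NaturalCoordinates

variable {n : ℕ} {Q : Type*} [TopologicalSpace Q] [ChartedSpace 𝔼(n) Q] [IsManifold (𝓡 n) ∞ Q]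

/-- The inverse of the natural chart of `TQ` induced by a chart `e` of `Q`: it sends `(x, v)` to
the tangent vector with coordinates `v` at the point with coordinates `x`. -/
def naturalParam (e : OpenPartialHomeomorph Q 𝔼(n)) (z : 𝔼(n) × 𝔼(n)) : TangentBundle (𝓡 n) Q :=
  ⟨e.symm z.1, mfderiv 𝓘(ℝ, 𝔼(n)) (𝓡 n) e.symm z.1 z.2⟩

variable {e : OpenPartialHomeomorph Q 𝔼(n)}

theorem contMDiffOn_naturalParam (he : e ∈ IsManifold.maximalAtlas (𝓡 n) ∞ Q) :
    ContMDiffOn 𝓘(ℝ, 𝔼(n) × 𝔼(n)) (𝓡 n).tangent ∞ (naturalParam e) (e.target ×ˢ univ) := by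
  have h1 : ContMDiffOn (𝓡 n).tangent (𝓡 n).tangent ∞
      (tangentMapWithin (𝓡 n) (𝓡 n) e.symm e.target) (Bundle.TotalSpace.proj ⁻¹' e.target) :=
    (contMDiffOn_symm_of_mem_maximalAtlas he).contMDiffOn_tangentMapWithin (by simp)
      e.open_target.uniqueMDiffOn
  have h2 : ContMDiff 𝓘(ℝ, 𝔼(n) × 𝔼(n)) (𝓡 n).tangent ∞
      (fun z : 𝔼(n) × 𝔼(n) => (⟨z.1, z.2⟩ : TangentBundle (𝓡 n) 𝔼(n))) := by
    rw [modelWithCornersSelf_prod]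
    exact contMDiff_tangentBundleModelSpaceHomeomorph_symm (I := 𝓡 n) (n := ∞)
  have h3 := h1.comp (t := Bundle.TotalSpace.proj ⁻¹' e.target)
    (s := (e.target ×ˢ univ : Set (𝔼(n) × 𝔼(n)))) h2.contMDiffOn (fun z hz => hz.1)
  refine h3.congr fun z hz => ?_
  have : mfderivWithin (𝓡 n) (𝓡 n) e.symm e.target z.1 = mfderiv (𝓡 n) (𝓡 n) e.symm z.1 :=
    mfderivWithin_of_isOpen e.open_target hz.1
  simp only [naturalParam, ← this]
  rfl

theorem mdifferentiableAt_naturalParam (he : e ∈ IsManifold.maximalAtlas (𝓡 n) ∞ Q)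
    {z : 𝔼(n) × 𝔼(n)} (hz : z.1 ∈ e.target) :
    MDifferentiableAt 𝓘(ℝ, 𝔼(n) × 𝔼(n)) (𝓡 n).tangent (naturalParam e) z :=
  ((contMDiffOn_naturalParam he).contMDiffAt
    ((e.open_target.prod isOpen_univ).mem_nhds ⟨hz, mem_univ _⟩)).mdifferentiableAt (by simp)

theorem mem_maximalAtlas_one (he : e ∈ IsManifold.maximalAtlas (𝓡 n) ∞ Q) :
    e ∈ IsManifold.maximalAtlas (𝓡 n) 1 Q :=
  IsManifold.maximalAtlas_subset_of_le (by simp) he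

theorem mfderiv_symm_mfderiv_apply (he : e ∈ IsManifold.maximalAtlas (𝓡 n) ∞ Q) {q : Q}
    (hq : q ∈ e.source) (w : 𝔼(n)) :
    mfderiv (𝓡 n) (𝓡 n) e.symm (e q) (mfderiv (𝓡 n) (𝓡 n) e q w) = w := by
  have h1 := mdifferentiableAt_of_mem_maximalAtlas (I := 𝓡 n) (mem_maximalAtlas_one he) hq
  have h2 := mdifferentiableAt_symm_of_mem_maximalAtlas (I := 𝓡 n) (mem_maximalAtlas_one he)
    (e.map_source hq)
  have h3 : HasMFDerivAt (𝓡 n) (𝓡 n) (e.symm ∘ e) q _ :=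
    HasMFDerivAt.comp q h2.hasMFDerivAt h1.hasMFDerivAt
  have h4 : (e.symm ∘ e) =ᶠ[𝓝 q] id := e.eventually_left_inverse hq
  have h5 := h3.congr_of_eventuallyEq h4.symm
  exact DFunLike.congr_fun (hasMFDerivAt_unique h5 (hasMFDerivAt_id q)) w

theorem mfderiv_mfderiv_symm_apply (he : e ∈ IsManifold.maximalAtlas (𝓡 n) ∞ Q) {x : 𝔼(n)}
    (hx : x ∈ e.target) (w : 𝔼(n)) :
    mfderiv (𝓡 n) (𝓡 n) e (e.symm x) (mfderiv (𝓡 n) (𝓡 n) e.symm x w) = w := by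
  have h1 := mdifferentiableAt_symm_of_mem_maximalAtlas (I := 𝓡 n) (mem_maximalAtlas_one he) hx
  have h2 := mdifferentiableAt_of_mem_maximalAtlas (I := 𝓡 n) (mem_maximalAtlas_one he)
    (e.map_target hx)
  have h3 : HasMFDerivAt (𝓡 n) (𝓡 n) (e ∘ e.symm) x _ :=
    HasMFDerivAt.comp x h2.hasMFDerivAt h1.hasMFDerivAt
  have h4 : (e ∘ e.symm) =ᶠ[𝓝 x] id := e.eventually_right_inverse hx
  have h5 := h3.congr_of_eventuallyEq h4.symm
  exact DFunLike.congr_fun (hasMFDerivAt_unique h5 (hasMFDerivAt_id x)) w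

/-- A tangent vector at `q` whose coordinates in the chart `e` are `u` is `naturalParam e (e q, u)`.
The equality `e.symm (e q) = q` of base points is not definitional, hence the form of the
hypothesis. -/
theorem mk_eq_naturalParam {q : Q} (hq : q ∈ e.source) {u w : 𝔼(n)}
    (h : mfderiv (𝓡 n) (𝓡 n) e.symm (e q) u = w) :
    (⟨q, w⟩ : TangentBundle (𝓡 n) Q) = naturalParam e (e q, u) := by
  have key : ∀ q' : Q, q' = q → (⟨q, w⟩ : TangentBundle (𝓡 n) Q) = ⟨q', w⟩ := by
    rintro _ rfl; rfl
  refine (key _ (e.left_inv hq)).trans ?_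
  subst h
  rfl

/-- The velocity of a curve in a chart, mapped back to the manifold. -/
theorem mfderiv_symm_derivWithin_chart (he : e ∈ IsManifold.maximalAtlas (𝓡 n) ∞ Q) {a b : ℝ}
    (hab : a < b) {c : ℝ → Q} {t : ℝ} (ht : t ∈ Icc a b) (hc : c t ∈ e.source)
    (hd : MDifferentiableWithinAt 𝓘(ℝ, ℝ) (𝓡 n) c (Icc a b) t) :
    mfderiv (𝓡 n) (𝓡 n) e.symm (e (c t))
      (derivWithin (fun s => e (c s)) (Icc a b) t : 𝔼(n)) =
      mfderivWithin 𝓘(ℝ, ℝ) (𝓡 n) c (Icc a b) t (1 : ℝ) := by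
  have h1 := mdifferentiableAt_of_mem_maximalAtlas (I := 𝓡 n) (mem_maximalAtlas_one he) hc
  have h2 : HasMFDerivWithinAt 𝓘(ℝ, ℝ) (𝓡 n) (e ∘ c) (Icc a b) t _ :=
    HasMFDerivAt.comp_hasMFDerivWithinAt t h1.hasMFDerivAt hd.hasMFDerivWithinAt
  have h3 : derivWithin (fun s => e (c s)) (Icc a b) t =
      mfderiv (𝓡 n) (𝓡 n) e (c t) (mfderivWithin 𝓘(ℝ, ℝ) (𝓡 n) c (Icc a b) t (1 : ℝ)) := by
    change fderivWithin ℝ (e ∘ c) (Icc a b) t 1 = _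
    rw [← mfderivWithin_eq_fderivWithin,
      h2.mfderivWithin (uniqueDiffOn_Icc hab t ht).uniqueMDiffWithinAt]
    rfl
  exact (congrArg (fun w : 𝔼(n) => (mfderiv (𝓡 n) (𝓡 n) e.symm (e (c t)) w : 𝔼(n))) h3).trans
    (mfderiv_symm_mfderiv_apply he hc _)

/-- The canonical lift of a curve in natural coordinates is the pair (position, velocity). -/
theorem canonicalLift_eq_naturalParam (he : e ∈ IsManifold.maximalAtlas (𝓡 n) ∞ Q) {a b : ℝ}
    (hab : a < b) {c : ℝ → Q} {t : ℝ} (ht : t ∈ Icc a b) (hc : c t ∈ e.source)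
    (hd : MDifferentiableWithinAt 𝓘(ℝ, ℝ) (𝓡 n) c (Icc a b) t) :
    canonicalLift a b c t =
      naturalParam e (e (c t), derivWithin (fun s => e (c s)) (Icc a b) t) :=
  mk_eq_naturalParam hc (mfderiv_symm_derivWithin_chart he hab ht hc hd)

/-- The inverse of a chart of `TQ` in the atlas is the parametrisation by natural coordinates. -/
theorem extChartAt_tangent_symm_eq (p : TangentBundle (𝓡 n) Q) {z : 𝔼(n) × 𝔼(n)}
    (hz : z.1 ∈ (chartAt 𝔼(n) p.proj).target) :
    (extChartAt (𝓡 n).tangent p).symm z = naturalParam (chartAt 𝔼(n) p.proj) z := by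
  have := tangentMap_chart_symm (I := 𝓡 n) (p := p) (q := ⟨z.1, z.2⟩) hz
  exact this.symm

/-- A chart of `TQ` in the atlas sends a tangent vector to its base point and its components in the
underlying chart of `Q`. -/
theorem extChartAt_tangent_apply {p q : TangentBundle (𝓡 n) Q}
    (hq : q.proj ∈ (chartAt 𝔼(n) p.proj).source) :
    extChartAt (𝓡 n).tangent p q =
      (chartAt 𝔼(n) p.proj q.proj, mfderiv (𝓡 n) (𝓡 n) (chartAt 𝔼(n) p.proj) q.proj q.snd) := by
  have := tangentMap_chart (I := 𝓡 n) (p := p) (q := q) hq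
  exact (congrArg (Bundle.TotalSpace.toProd _ _) this).symm

variable {L : TangentBundle (𝓡 n) Q → ℝ}

/-- The Lagrangian in natural coordinates, as a function of the pair `(x, v)`. -/
def coordLagrangian (L : TangentBundle (𝓡 n) Q → ℝ) (e : OpenPartialHomeomorph Q 𝔼(n))
    (z : 𝔼(n) × 𝔼(n)) : ℝ := L (naturalParam e z)

theorem contDiffOn_coordLagrangian (hL : ContMDiff (𝓡 n).tangent 𝓘(ℝ, ℝ) ∞ L)
    (he : e ∈ IsManifold.maximalAtlas (𝓡 n) ∞ Q) :
    ContDiffOn ℝ ∞ (coordLagrangian L e) (e.target ×ˢ univ) :=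
  contMDiffOn_iff_contDiffOn.1 (hL.comp_contMDiffOn (contMDiffOn_naturalParam he))

theorem contDiffAt_coordLagrangian (hL : ContMDiff (𝓡 n).tangent 𝓘(ℝ, ℝ) ∞ L)
    (he : e ∈ IsManifold.maximalAtlas (𝓡 n) ∞ Q) {z : 𝔼(n) × 𝔼(n)} (hz : z.1 ∈ e.target) :
    ContDiffAt ℝ ∞ (coordLagrangian L e) z :=
  (contDiffOn_coordLagrangian hL he).contDiffAt
    ((e.open_target.prod isOpen_univ).mem_nhds ⟨hz, mem_univ _⟩)

theorem contDiffWithinAt_chart_comp (he : e ∈ IsManifold.maximalAtlas (𝓡 n) ∞ Q) {a b : ℝ}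
    {γ : ℝ → Q} (hγ : ContMDiffOn 𝓘(ℝ, ℝ) (𝓡 n) 2 γ (Icc a b)) {t : ℝ} (ht : t ∈ Icc a b)
    (hs : γ t ∈ e.source) : ContDiffWithinAt ℝ 2 (fun s => e (γ s)) (Icc a b) t := by
  have h1 : ContMDiffAt (𝓡 n) 𝓘(ℝ, 𝔼(n)) 2 e (γ t) :=
    ((contMDiffOn_of_mem_maximalAtlas he).contMDiffAt (e.open_source.mem_nhds hs)).of_le
      (WithTop.coe_le_coe.2 (le_top : (2 : ℕ∞) ≤ ⊤))
  exact contMDiffWithinAt_iff_contDiffWithinAt.1 (h1.comp_contMDiffWithinAt t (hγ t ht))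

theorem contDiffWithinAt_velocity {F : Type*} [NormedAddCommGroup F] [NormedSpace ℝ F] {a b : ℝ}
    (hab : a < b) {x : ℝ → F} {t : ℝ} (ht : t ∈ Icc a b)
    (hx : ContDiffWithinAt ℝ 2 x (Icc a b) t) :
    ContDiffWithinAt ℝ 1 (derivWithin x (Icc a b)) (Icc a b) t := by
  have h := (hx.fderivWithin_right (m := 1) (uniqueDiffOn_Icc hab) (by norm_num) ht).clm_apply
    (contDiffWithinAt_const (c := (1 : ℝ)))
  exact h

end NaturalCoordinates

/-! ### The first variation on a vector space -/

section CoordinateCalculus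

variable {V : Type*} [NormedAddCommGroup V] [NormedSpace ℝ V]

/-- The Euler–Lagrange covector `∂Λ/∂x - d/dt ∂Λ/∂v` of a Lagrangian `Λ(x, v)` on a vector space
along a curve `x`, applied to a vector `w`. -/
def eulerLagrangeResidual (Λ : V × V → ℝ) (x : ℝ → V) (S : Set ℝ) (t : ℝ) (w : V) : ℝ :=
  fderiv ℝ Λ (x t, derivWithin x S t) (w, 0) -
    derivWithin (fun s => fderiv ℝ Λ (x s, derivWithin x S s) (0, w)) S t

/-- The Lagrangian along a variation `f (s, ·)` of the identity, prolonged to velocities. -/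
def variedLagrangian (Λ : V × V → ℝ) (f : ℝ × V → V) (p : ℝ × V × V) : ℝ :=
  Λ (f (p.1, p.2.1), fderiv ℝ f (p.1, p.2.1) (0, p.2.2))

variable {Λ : V × V → ℝ} {f : ℝ × V → V} {x₀ v₀ : V}

/-- A family of maps that is the identity at parameter `0` has the identity as its spatial
derivative at parameter `0`. -/
theorem fderiv_apply_zero_right_of_eventually_eq_id (hf : DifferentiableAt ℝ f (0, x₀))
    (hid : ∀ᶠ y in 𝓝 x₀, f (0, y) = y) (u : V) : fderiv ℝ f (0, x₀) (0, u) = u := by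
  have h1 : HasFDerivAt (fun y : V => f (0, y)) _ x₀ :=
    HasFDerivAt.comp x₀ (g := f) hf.hasFDerivAt (hasFDerivAt_prodMk_right (0 : ℝ) x₀)
  have h2 : HasFDerivAt (fun y : V => f (0, y)) (ContinuousLinearMap.id ℝ V) x₀ :=
    (hasFDerivAt_id x₀).congr_of_eventuallyEq hid
  exact DFunLike.congr_fun (h1.unique h2) u

/-- One derivative is lost because the prolongation of `f` to velocities involves its derivative. -/
theorem contDiffAt_variedLagrangian (hf : ContDiffAt ℝ 2 f (0, x₀))
    (hid : ∀ᶠ y in 𝓝 x₀, f (0, y) = y) (hΛ : ContDiffAt ℝ 2 Λ (x₀, v₀)) :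
    ContDiffAt ℝ 1 (variedLagrangian Λ f) (0, x₀, v₀) := by
  have hp : ContDiffAt ℝ 2 (fun p : ℝ × V × V => (p.1, p.2.1)) (0, x₀, v₀) := by fun_prop
  have h1 : ContDiffAt ℝ 1 (fun p : ℝ × V × V => f (p.1, p.2.1)) (0, x₀, v₀) :=
    (ContDiffAt.comp (0, x₀, v₀) (g := f) hf hp).of_le (by norm_num)
  have h2 : ContDiffAt ℝ 1 (fun p : ℝ × V × V => fderiv ℝ f (p.1, p.2.1)) (0, x₀, v₀) :=
    ContDiffAt.comp (0, x₀, v₀) (g := fderiv ℝ f) (hf.fderiv_right (by norm_num))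
      (hp.of_le (by norm_num))
  have h3 : ContDiffAt ℝ 1 (fun p : ℝ × V × V => fderiv ℝ f (p.1, p.2.1) (0, p.2.2))
      (0, x₀, v₀) := h2.clm_apply (by fun_prop)
  have hval : (f (0, x₀), fderiv ℝ f (0, x₀) (0, v₀)) = (x₀, v₀) := by
    rw [hid.self_of_nhds, fderiv_apply_zero_right_of_eventually_eq_id
      (hf.differentiableAt (by norm_num)) hid]
  refine ContDiffAt.comp (0, x₀, v₀) (g := Λ) ?_ (h1.prodMk h3)
  change ContDiffAt ℝ 1 Λ (f (0, x₀), fderiv ℝ f (0, x₀) (0, v₀))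
  rw [hval]
  exact hΛ.of_le (by norm_num)

/-- The derivative of the varied Lagrangian in the parameter of the variation; the velocity of
the variation of `v` is the derivative of the variation field, by symmetry of the second
derivative. -/
theorem hasDerivAt_variedLagrangian (hf : ContDiffAt ℝ 2 f (0, x₀))
    (hid : ∀ᶠ y in 𝓝 x₀, f (0, y) = y) (hΛ : DifferentiableAt ℝ Λ (x₀, v₀)) :
    HasDerivAt (fun s => variedLagrangian Λ f (s, x₀, v₀))
      (fderiv ℝ Λ (x₀, v₀) (fderiv ℝ f (0, x₀) (1, 0),
        fderiv ℝ (fun y => fderiv ℝ f (0, y) (1, 0)) x₀ v₀)) 0 := by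
  have hfd : DifferentiableAt ℝ f (0, x₀) := hf.differentiableAt (by norm_num)
  have hfd2 : DifferentiableAt ℝ (fderiv ℝ f) (0, x₀) :=
    (hf.fderiv_right (m := 1) (by norm_num)).differentiableAt (by norm_num)
  have hline : HasDerivAt (fun s : ℝ => (s, x₀)) ((1 : ℝ), (0 : V)) 0 :=
    (hasDerivAt_id (0 : ℝ)).prodMk (hasDerivAt_const _ _)
  have h1 : HasDerivAt (fun s : ℝ => f (s, x₀)) (fderiv ℝ f (0, x₀) (1, 0)) 0 :=
    HasFDerivAt.comp_hasDerivAt (0 : ℝ) (l := f) (f := fun s => (s, x₀)) hfd.hasFDerivAt hline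
  have h2 : HasDerivAt (fun s : ℝ => fderiv ℝ f (s, x₀) (0, v₀))
      (fderiv ℝ (fderiv ℝ f) (0, x₀) (1, 0) (0, v₀)) 0 := by
    have h := HasFDerivAt.comp_hasDerivAt (0 : ℝ) (l := fderiv ℝ f) (f := fun s => (s, x₀))
      hfd2.hasFDerivAt hline
    have h' := HasDerivAt.clm_apply h (hasDerivAt_const (0 : ℝ) ((0 : ℝ), v₀))
    simpa using h'
  have h3 : fderiv ℝ (fun y => fderiv ℝ f (0, y) (1, 0)) x₀ v₀ =
      fderiv ℝ (fderiv ℝ f) (0, x₀) (0, v₀) (1, 0) := by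
    have h : HasFDerivAt (fun y : V => fderiv ℝ f (0, y)) _ x₀ :=
      HasFDerivAt.comp x₀ (g := fderiv ℝ f) hfd2.hasFDerivAt (hasFDerivAt_prodMk_right (0 : ℝ) x₀)
    have h' := (h.clm_apply (hasFDerivAt_const ((1 : ℝ), (0 : V)) x₀)).fderiv
    rw [h']
    simp
  -- the mixed derivatives in the parameter and in space commute
  have hsymm : IsSymmSndFDerivAt ℝ f (0, x₀) := hf.isSymmSndFDerivAt (by simp)
  rw [h3, hsymm.eq]
  have hval : (f (0, x₀), fderiv ℝ f (0, x₀) (0, v₀)) = (x₀, v₀) := by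
    rw [hid.self_of_nhds, fderiv_apply_zero_right_of_eventually_eq_id hfd hid]
  have h4 := h1.prodMk h2
  exact HasFDerivAt.comp_hasDerivAt_of_eq (0 : ℝ) hΛ.hasFDerivAt h4 hval.symm

variable {x : ℝ → V} {a b t : ℝ}

/-- `∂Λ/∂v` along a `C²` curve is continuously differentiable in time. -/
theorem contDiffWithinAt_momentum (hab : a < b) (ht : t ∈ Icc a b)
    (hx : ContDiffWithinAt ℝ 2 x (Icc a b) t)
    (hΛ : ContDiffAt ℝ 2 Λ (x t, derivWithin x (Icc a b) t)) :
    ContDiffWithinAt ℝ 1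
      (fun s => (fderiv ℝ Λ (x s, derivWithin x (Icc a b) s)).comp (.inr ℝ V V)) (Icc a b) t := by
  have h1 : ContDiffWithinAt ℝ 1 (fun s => fderiv ℝ Λ (x s, derivWithin x (Icc a b) s))
      (Icc a b) t :=
    ContDiffAt.comp_contDiffWithinAt t (g := fderiv ℝ Λ) (hΛ.fderiv_right (by norm_num))
      ((hx.of_le (by norm_num)).prodMk (contDiffWithinAt_velocity hab ht hx))
  exact h1.clm_comp contDiffWithinAt_const

theorem differentiableWithinAt_momentum_apply (hab : a < b) (ht : t ∈ Icc a b)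
    (hx : ContDiffWithinAt ℝ 2 x (Icc a b) t)
    (hΛ : ContDiffAt ℝ 2 Λ (x t, derivWithin x (Icc a b) t)) (w : V) :
    DifferentiableWithinAt ℝ (fun s => fderiv ℝ Λ (x s, derivWithin x (Icc a b) s) (0, w))
      (Icc a b) t :=
  ((contDiffWithinAt_momentum hab ht hx hΛ).differentiableWithinAt (by norm_num)).clm_apply
    (differentiableWithinAt_const w)

/-- The momentum of a vector field `ξ` along the curve is continuously differentiable in time. -/
theorem contDiffWithinAt_momentum_field (hab : a < b) (ht : t ∈ Icc a b)
    (hx : ContDiffWithinAt ℝ 2 x (Icc a b) t)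
    (hΛ : ContDiffAt ℝ 2 Λ (x t, derivWithin x (Icc a b) t)) {ξ : V → V}
    (hξ : ContDiffAt ℝ 1 ξ (x t)) :
    ContDiffWithinAt ℝ 1 (fun s => fderiv ℝ Λ (x s, derivWithin x (Icc a b) s) (0, ξ (x s)))
      (Icc a b) t :=
  (contDiffWithinAt_momentum hab ht hx hΛ).clm_apply
    (ContDiffAt.comp_contDiffWithinAt t (g := ξ) hξ (hx.of_le (by norm_num)))

/-- Leibniz rule for the momentum of a vector field. -/
theorem derivWithin_momentum_field (hab : a < b) (ht : t ∈ Icc a b)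
    (hx : ContDiffWithinAt ℝ 2 x (Icc a b) t)
    (hΛ : ContDiffAt ℝ 2 Λ (x t, derivWithin x (Icc a b) t)) {ξ : V → V}
    (hξ : DifferentiableAt ℝ ξ (x t)) :
    derivWithin (fun s => fderiv ℝ Λ (x s, derivWithin x (Icc a b) s) (0, ξ (x s))) (Icc a b) t =
      derivWithin (fun s => fderiv ℝ Λ (x s, derivWithin x (Icc a b) s) (0, ξ (x t)))
          (Icc a b) t +
        fderiv ℝ Λ (x t, derivWithin x (Icc a b) t)
          (0, fderiv ℝ ξ (x t) (derivWithin x (Icc a b) t)) := by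
  have hu := uniqueDiffOn_Icc hab t ht
  have h1 := ((contDiffWithinAt_momentum hab ht hx hΛ).differentiableWithinAt
    (by norm_num)).hasDerivWithinAt
  have hxd := (hx.differentiableWithinAt (by norm_num)).hasDerivWithinAt
  have h2 : HasDerivWithinAt (fun s => ξ (x s)) (fderiv ℝ ξ (x t) (derivWithin x (Icc a b) t))
      (Icc a b) t := HasFDerivAt.comp_hasDerivWithinAt t (l := ξ) hξ.hasFDerivAt hxd
  have h3 := (h1.clm_apply h2).derivWithin hu
  have h4 := (h1.clm_apply (hasDerivWithinAt_const t (Icc a b) (ξ (x t)))).derivWithin hu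
  refine h3.trans ?_
  rw [map_zero, add_zero] at h4
  rw [← h4]
  rfl

/-- First variation formula at one time: integration by parts in differential form. -/
theorem hasDerivAt_variedLagrangian_eq_residual (hab : a < b) (ht : t ∈ Icc a b)
    (hx : ContDiffWithinAt ℝ 2 x (Icc a b) t)
    (hΛ : ContDiffAt ℝ 2 Λ (x t, derivWithin x (Icc a b) t))
    (hf : ContDiffAt ℝ 2 f (0, x t)) (hid : ∀ᶠ y in 𝓝 (x t), f (0, y) = y) :
    HasDerivAt (fun s => variedLagrangian Λ f (s, x t, derivWithin x (Icc a b) t))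
      (eulerLagrangeResidual Λ x (Icc a b) t (fderiv ℝ f (0, x t) (1, 0)) +
        derivWithin (fun s => fderiv ℝ Λ (x s, derivWithin x (Icc a b) s)
          (0, fderiv ℝ f (0, x s) (1, 0))) (Icc a b) t) 0 := by
  have hξ : DifferentiableAt ℝ (fun y => fderiv ℝ f (0, y) (1, 0)) (x t) := by
    have h : ContDiffAt ℝ 1 (fun y : V => fderiv ℝ f (0, y)) (x t) :=
      ContDiffAt.comp (x t) (g := fderiv ℝ f) (hf.fderiv_right (by norm_num)) (by fun_prop)
    exact (h.differentiableAt (by norm_num)).clm_apply (differentiableAt_const _)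
  refine (hasDerivAt_variedLagrangian hf hid (hΛ.differentiableAt (by norm_num))).congr_deriv ?_
  rw [derivWithin_momentum_field hab ht hx hΛ (ξ := fun y => fderiv ℝ f (0, y) (1, 0)) hξ,
    eulerLagrangeResidual, ← add_assoc, sub_add_cancel, ← map_add]
  simp

end CoordinateCalculus

/-! ### The first variation along a curve on a manifold -/

section LocalFirstVariation

variable {n : ℕ} {Q : Type*} [TopologicalSpace Q] [ChartedSpace 𝔼(n) Q] [IsManifold (𝓡 n) ∞ Q]

/-- A variation `F (s, q)` of the identity of `Q` in a chart `e`. -/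
def coordVariation (e : OpenPartialHomeomorph Q 𝔼(n)) (F : ℝ → Q → Q) (p : ℝ × 𝔼(n)) : 𝔼(n) :=
  e (F p.1 (e.symm p.2))

/-- The momentum `∂L/∂v` along the canonical lift of `γ`, paired with a vector field `X`: the
derivative of `L` in the direction of the vertical lift of `X`. No chart enters, so this is the
same function of time whichever chart is used to compute the first variation. -/
def momentumPairing (L : TangentBundle (𝓡 n) Q → ℝ) (a b : ℝ) (γ : ℝ → Q)
    (X : ∀ q : Q, TangentSpace (𝓡 n) q) (t : ℝ) : ℝ :=
  deriv (fun u : ℝ =>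
    L ⟨γ t, (mfderivWithin 𝓘(ℝ, ℝ) (𝓡 n) γ (Icc a b) t (1 : ℝ) : TangentSpace (𝓡 n) (γ t)) +
      u • X (γ t)⟩) 0

/-- The Lagrangian along the canonical lifts of the varied curves `F s ∘ γ`. -/
def liftedVariation (L : TangentBundle (𝓡 n) Q → ℝ) (a b : ℝ) (γ : ℝ → Q) (F : ℝ → Q → Q)
    (s t : ℝ) : ℝ :=
  L (canonicalLift a b (fun τ => F s (γ τ)) t)

variable {L : TangentBundle (𝓡 n) Q → ℝ} {e : OpenPartialHomeomorph Q 𝔼(n)} {a b : ℝ}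
  {γ : ℝ → Q} {F : ℝ → Q → Q} {t₀ : ℝ}

theorem contDiffAt_coordVariation (he : e ∈ IsManifold.maximalAtlas (𝓡 n) ∞ Q) {q₀ : Q}
    (hq₀ : q₀ ∈ e.source)
    (hF : ContMDiffAt (𝓘(ℝ, ℝ).prod (𝓡 n)) (𝓡 n) 2 (uncurry F) (0, q₀)) (h0 : F 0 q₀ = q₀) :
    ContDiffAt ℝ 2 (coordVariation e F) (0, e q₀) := by
  have h2 : (2 : WithTop ℕ∞) ≤ ∞ := WithTop.coe_le_coe.2 (le_top : (2 : ℕ∞) ≤ ⊤)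
  have he1 : ContMDiffAt (𝓡 n) 𝓘(ℝ, 𝔼(n)) 2 e (F 0 q₀) := by
    rw [h0]
    exact ((contMDiffOn_of_mem_maximalAtlas he).contMDiffAt (e.open_source.mem_nhds hq₀)).of_le h2
  have he2 : ContMDiffAt 𝓘(ℝ, 𝔼(n)) (𝓡 n) 2 e.symm (e q₀) :=
    ((contMDiffOn_symm_of_mem_maximalAtlas he).contMDiffAt
      (e.open_target.mem_nhds (e.map_source hq₀))).of_le h2
  have h3 : ContMDiffAt 𝓘(ℝ, ℝ × 𝔼(n)) 𝓘(ℝ, ℝ) 2 (fun p : ℝ × 𝔼(n) => p.1) (0, e q₀) :=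
    contDiffAt_fst.contMDiffAt
  have h4 : ContMDiffAt 𝓘(ℝ, ℝ × 𝔼(n)) 𝓘(ℝ, 𝔼(n)) 2 (fun p : ℝ × 𝔼(n) => p.2) (0, e q₀) :=
    contDiffAt_snd.contMDiffAt
  have h5 := h3.prodMk (ContMDiffAt.comp (0, e q₀) (g := e.symm) he2 h4)
  have h6 : ContMDiffAt 𝓘(ℝ, ℝ × 𝔼(n)) (𝓡 n) 2
      (fun p : ℝ × 𝔼(n) => F p.1 (e.symm p.2)) (0, e q₀) := by
    refine ContMDiffAt.comp_of_eq (g := uncurry F) (f := fun p : ℝ × 𝔼(n) => (p.1, e.symm p.2))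
      hF h5 ?_
    rw [e.left_inv hq₀]
  refine contMDiffAt_iff_contDiffAt.1 (ContMDiffAt.comp_of_eq (g := e) he1 h6 ?_)
  rw [e.left_inv hq₀]

theorem eventually_coordVariation_zero {q₀ : Q} (hq₀ : q₀ ∈ e.source)
    (hid : ∀ᶠ q in 𝓝 q₀, F 0 q = q) :
    ∀ᶠ y in 𝓝 (e q₀), coordVariation e F (0, y) = y := by
  have h1 : ∀ᶠ y in 𝓝 (e q₀), F 0 (e.symm y) = e.symm y := by
    have := e.continuousAt_symm (e.map_source hq₀)
    rw [ContinuousAt, e.left_inv hq₀] at this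
    exact this.eventually hid
  filter_upwards [h1, e.open_target.mem_nhds (e.map_source hq₀)] with y hy hy'
  simp only [coordVariation]
  rw [hy, e.right_inv hy']

/-- Near a time at which the curve is in the domain of the chart, the Lagrangian along the varied
curves is the varied Lagrangian in natural coordinates. -/
theorem eventually_liftedVariation_eq (he : e ∈ IsManifold.maximalAtlas (𝓡 n) ∞ Q) (hab : a < b)
    (hγ : ContMDiffOn 𝓘(ℝ, ℝ) (𝓡 n) 2 γ (Icc a b)) (ht₀ : t₀ ∈ Icc a b)
    (hs : γ t₀ ∈ e.source)
    (hF : ContMDiffAt (𝓘(ℝ, ℝ).prod (𝓡 n)) (𝓡 n) 2 (uncurry F) (0, γ t₀))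
    (h0 : F 0 (γ t₀) = γ t₀) :
    ∀ᶠ p : ℝ × ℝ in 𝓝 0 ×ˢ 𝓝[Icc a b] t₀,
      liftedVariation L a b γ F p.1 p.2 =
        variedLagrangian (coordLagrangian L e) (coordVariation e F)
          (p.1, e (γ p.2), derivWithin (fun s => e (γ s)) (Icc a b) p.2) := by
  have hγc : Filter.Tendsto γ (𝓝[Icc a b] t₀) (𝓝 (γ t₀)) := (hγ t₀ ht₀).continuousWithinAt
  have hsrc : ∀ᶠ t in 𝓝[Icc a b] t₀, γ t ∈ e.source := hγc.eventually
    (e.open_source.mem_nhds hs)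
  have hpair : Filter.Tendsto (fun p : ℝ × ℝ => (p.1, γ p.2)) (𝓝 0 ×ˢ 𝓝[Icc a b] t₀)
      (𝓝 (0, γ t₀)) := by
    rw [nhds_prod_eq]
    exact Filter.tendsto_id.prodMap hγc
  have hxc : Filter.Tendsto (fun p : ℝ × ℝ => (p.1, e (γ p.2))) (𝓝 0 ×ˢ 𝓝[Icc a b] t₀)
      (𝓝 (0, e (γ t₀))) := by
    rw [nhds_prod_eq]
    exact Filter.tendsto_id.prodMap ((e.continuousAt hs).tendsto.comp hγc)
  have hsm : ∀ᶠ p : ℝ × ℝ in 𝓝 0 ×ˢ 𝓝[Icc a b] t₀,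
      ContMDiffAt (𝓘(ℝ, ℝ).prod (𝓡 n)) (𝓡 n) 2 (uncurry F) (p.1, γ p.2) :=
    hpair.eventually ((contMDiffAt_iff_contMDiffAt_nhds (by simp)).1 hF)
  have hFsrc : ∀ᶠ p : ℝ × ℝ in 𝓝 0 ×ˢ 𝓝[Icc a b] t₀, F p.1 (γ p.2) ∈ e.source := by
    refine hpair.eventually (hF.continuousAt.eventually (e.open_source.mem_nhds ?_))
    change F 0 (γ t₀) ∈ e.source
    rwa [h0]
  have hcd : ∀ᶠ p : ℝ × ℝ in 𝓝 0 ×ˢ 𝓝[Icc a b] t₀,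
      ContDiffAt ℝ 2 (coordVariation e F) (p.1, e (γ p.2)) :=
    hxc.eventually ((contDiffAt_coordVariation he hs hF h0).eventually (by simp))
  have hIcc : ∀ᶠ t in 𝓝[Icc a b] t₀, t ∈ Icc a b := self_mem_nhdsWithin
  filter_upwards [hsm, hFsrc, hcd, hsrc.prod_inr (𝓝 0), hIcc.prod_inr (𝓝 0)]
    with p h1 h2 h3 h4 h5
  obtain ⟨s, t⟩ := p
  simp only at h1 h2 h3 h4 h5 ⊢
  have hd : MDifferentiableWithinAt 𝓘(ℝ, ℝ) (𝓡 n) (fun τ => F s (γ τ)) (Icc a b) t := by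
    have h6 : ContMDiffWithinAt 𝓘(ℝ, ℝ) (𝓘(ℝ, ℝ).prod (𝓡 n)) 2 (fun τ => (s, γ τ))
        (Icc a b) t := contMDiffWithinAt_const.prodMk (hγ t h5)
    exact (ContMDiffAt.comp_contMDiffWithinAt t (g := uncurry F) h1 h6).mdifferentiableWithinAt
      (by simp)
  rw [liftedVariation, canonicalLift_eq_naturalParam he hab h5 h2 hd]
  have hxd := (contDiffWithinAt_chart_comp he hγ h5 h4).differentiableWithinAt (by norm_num)
  have hev : (fun τ => e (F s (γ τ))) =ᶠ[𝓝[Icc a b] t]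
      fun τ => coordVariation e F (s, e (γ τ)) := by
    filter_upwards [(hγ t h5).continuousWithinAt.eventually (e.open_source.mem_nhds h4)] with τ hτ
    simp only [coordVariation]
    rw [e.left_inv hτ]
  have hval : e (F s (γ t)) = coordVariation e F (s, e (γ t)) := hev.self_of_nhdsWithin h5
  have hder : derivWithin (fun τ => e (F s (γ τ))) (Icc a b) t =
      fderiv ℝ (coordVariation e F) (s, e (γ t))
        (0, derivWithin (fun s => e (γ s)) (Icc a b) t) := by
    rw [hev.derivWithin_eq hval]
    have h6 : HasDerivWithinAt (fun τ => (s, e (γ τ)))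
        ((0 : ℝ), derivWithin (fun s => e (γ s)) (Icc a b) t) (Icc a b) t :=
      (hasDerivWithinAt_const t (Icc a b) s).prodMk hxd.hasDerivWithinAt
    exact (HasFDerivAt.comp_hasDerivWithinAt t (l := coordVariation e F)
      (h3.differentiableAt (by norm_num)).hasFDerivAt h6).derivWithin (uniqueDiffOn_Icc hab t h5)
  rw [hval, hder]
  rfl

/-- The velocity of a variation of the identity in a chart. -/
theorem fderiv_coordVariation (he : e ∈ IsManifold.maximalAtlas (𝓡 n) ∞ Q) {q : Q}
    (hq : q ∈ e.source)
    (hF : ContMDiffAt (𝓘(ℝ, ℝ).prod (𝓡 n)) (𝓡 n) 2 (uncurry F) (0, q)) (h0 : F 0 q = q) :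
    fderiv ℝ (coordVariation e F) (0, e q) (1, 0) =
      mfderiv (𝓡 n) (𝓡 n) e q (mfderiv 𝓘(ℝ, ℝ) (𝓡 n) (fun s => F s q) 0 (1 : ℝ)) := by
  have h1 := (contDiffAt_coordVariation he hq hF h0).differentiableAt (by norm_num)
  have h2 : HasDerivAt (fun s : ℝ => coordVariation e F (s, e q))
      (fderiv ℝ (coordVariation e F) (0, e q) (1, 0)) 0 :=
    HasFDerivAt.comp_hasDerivAt (0 : ℝ) (l := coordVariation e F) (f := fun s => (s, e q))
      h1.hasFDerivAt ((hasDerivAt_id (0 : ℝ)).prodMk (hasDerivAt_const _ _))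
  have h3 : (fun s : ℝ => coordVariation e F (s, e q)) = e ∘ fun s => F s q := by
    funext s
    simp only [coordVariation, comp]
    rw [e.left_inv hq]
  have h4 : MDifferentiableAt 𝓘(ℝ, ℝ) (𝓡 n) (fun s => F s q) 0 := by
    have h5 : ContMDiffAt 𝓘(ℝ, ℝ) (𝓘(ℝ, ℝ).prod (𝓡 n)) 2 (fun s : ℝ => (s, q)) 0 :=
      contMDiffAt_id.prodMk contMDiffAt_const
    exact (ContMDiffAt.comp (0 : ℝ) (g := uncurry F) hF h5).mdifferentiableAt (by simp)
  have h5 : MDifferentiableAt (𝓡 n) (𝓡 n) e (F 0 q) := by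
    rw [h0]
    exact mdifferentiableAt_of_mem_maximalAtlas (I := 𝓡 n) (mem_maximalAtlas_one he) hq
  have h6 := mfderiv_comp_apply (0 : ℝ) h5 h4 (1 : ℝ)
  rw [h0] at h6
  refine Eq.trans ?_ h6
  rw [← h2.deriv, h3, mfderiv_eq_fderiv]
  rfl

/-- In a chart, the momentum pairing is `(∂L/∂v) · ξ`, with `ξ` the components of the field. -/
theorem momentumPairing_eq (hL : ContMDiff (𝓡 n).tangent 𝓘(ℝ, ℝ) ∞ L)
    (he : e ∈ IsManifold.maximalAtlas (𝓡 n) ∞ Q) (hab : a < b)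
    (hγ : ContMDiffOn 𝓘(ℝ, ℝ) (𝓡 n) 2 γ (Icc a b)) {t : ℝ} (ht : t ∈ Icc a b)
    (hs : γ t ∈ e.source) (X : ∀ q : Q, TangentSpace (𝓡 n) q) :
    momentumPairing L a b γ X t =
      fderiv ℝ (coordLagrangian L e)
        (e (γ t), derivWithin (fun s => e (γ s)) (Icc a b) t)
        (0, mfderiv (𝓡 n) (𝓡 n) e (γ t) (X (γ t))) := by
  set x := e (γ t)
  set v := derivWithin (fun s => e (γ s)) (Icc a b) t
  set w : 𝔼(n) := mfderiv (𝓡 n) (𝓡 n) e (γ t) (X (γ t))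
  have hv : mfderiv (𝓡 n) (𝓡 n) e.symm x v =
      mfderivWithin 𝓘(ℝ, ℝ) (𝓡 n) γ (Icc a b) t (1 : ℝ) :=
    mfderiv_symm_derivWithin_chart he hab ht hs ((hγ t ht).mdifferentiableWithinAt (by simp))
  have hpt : ∀ u : ℝ, (⟨γ t, (mfderivWithin 𝓘(ℝ, ℝ) (𝓡 n) γ (Icc a b) t (1 : ℝ) :
      TangentSpace (𝓡 n) (γ t)) + u • X (γ t)⟩ : TangentBundle (𝓡 n) Q) =
        naturalParam e (x, v + u • w) := by
    intro u
    refine mk_eq_naturalParam hs ?_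
    let T : 𝔼(n) →L[ℝ] 𝔼(n) := mfderiv (𝓡 n) (𝓡 n) e.symm x
    have hw : T w = X (γ t) := mfderiv_symm_mfderiv_apply he hs _
    have h1 : T (v + u • w) = T v + u • T w := by rw [map_add, map_smul]
    exact h1.trans (congrArg₂ (fun y z : 𝔼(n) => y + u • z) hv hw)
  have hd : DifferentiableAt ℝ (coordLagrangian L e) (x, v) :=
    (contDiffAt_coordLagrangian hL he (e.map_source hs)).differentiableAt (by simp)
  have hline : HasDerivAt (fun u : ℝ => (x, v + u • w)) (0, w) 0 := by
    have := (hasDerivAt_const (0 : ℝ) x).prodMk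
      (((hasDerivAt_id (0 : ℝ)).smul_const w).const_add v)
    simpa using this
  have h := HasFDerivAt.comp_hasDerivAt_of_eq (0 : ℝ) hd.hasFDerivAt hline (by simp)
  rw [momentumPairing]
  simp only [hpt]
  exact h.deriv

variable {X : ∀ q : Q, TangentSpace (𝓡 n) q}

theorem contDiffAt_coordLagrangian_two (hL : ContMDiff (𝓡 n).tangent 𝓘(ℝ, ℝ) ∞ L)
    (he : e ∈ IsManifold.maximalAtlas (𝓡 n) ∞ Q) {z : 𝔼(n) × 𝔼(n)} (hz : z.1 ∈ e.target) :
    ContDiffAt ℝ 2 (coordLagrangian L e) z :=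
  (contDiffAt_coordLagrangian hL he hz).of_le (WithTop.coe_le_coe.2 (le_top : (2 : ℕ∞) ≤ ⊤))

/-- The momentum pairing with the velocity field of a variation `F` of the identity, in a chart. -/
theorem momentumPairing_eventuallyEq (hL : ContMDiff (𝓡 n).tangent 𝓘(ℝ, ℝ) ∞ L)
    (he : e ∈ IsManifold.maximalAtlas (𝓡 n) ∞ Q) (hab : a < b)
    (hγ : ContMDiffOn 𝓘(ℝ, ℝ) (𝓡 n) 2 γ (Icc a b)) (ht₀ : t₀ ∈ Icc a b)
    (hs : γ t₀ ∈ e.source)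
    (hF : ContMDiffAt (𝓘(ℝ, ℝ).prod (𝓡 n)) (𝓡 n) 2 (uncurry F) (0, γ t₀))
    (hid : ∀ᶠ q in 𝓝 (γ t₀), F 0 q = q)
    (hX : ∀ᶠ q in 𝓝 (γ t₀),
      (mfderiv 𝓘(ℝ, ℝ) (𝓡 n) (fun s => F s q) 0 (1 : ℝ) : 𝔼(n)) = X q) :
    momentumPairing L a b γ X =ᶠ[𝓝[Icc a b] t₀] fun s =>
      fderiv ℝ (coordLagrangian L e) (e (γ s), derivWithin (fun s => e (γ s)) (Icc a b) s)
        (0, fderiv ℝ (coordVariation e F) (0, e (γ s)) (1, 0)) := by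
  have hγc : Filter.Tendsto γ (𝓝[Icc a b] t₀) (𝓝 (γ t₀)) := (hγ t₀ ht₀).continuousWithinAt
  have hsm : ∀ᶠ q in 𝓝 (γ t₀),
      ContMDiffAt (𝓘(ℝ, ℝ).prod (𝓡 n)) (𝓡 n) 2 (uncurry F) (0, q) := by
    have h : Filter.Tendsto (fun q : Q => ((0 : ℝ), q)) (𝓝 (γ t₀)) (𝓝 (0, γ t₀)) :=
      (Continuous.prodMk_right (0 : ℝ)).tendsto _
    exact h.eventually ((contMDiffAt_iff_contMDiffAt_nhds (by simp)).1 hF)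
  filter_upwards [self_mem_nhdsWithin, hγc.eventually (e.open_source.mem_nhds hs),
    hγc.eventually hsm, hγc.eventually hid, hγc.eventually hX] with t h1 h2 h3 h4 h5
  rw [momentumPairing_eq hL he hab hγ h1 h2 X, fderiv_coordVariation he h2 h3 h4]
  exact congrArg (fun w : 𝔼(n) => fderiv ℝ (coordLagrangian L e)
    (e (γ t), derivWithin (fun s => e (γ s)) (Icc a b) t)
      (0, mfderiv (𝓡 n) (𝓡 n) e (γ t) w)) h5.symm

theorem contDiffAt_variationField (he : e ∈ IsManifold.maximalAtlas (𝓡 n) ∞ Q) {q₀ : Q}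
    (hq₀ : q₀ ∈ e.source)
    (hF : ContMDiffAt (𝓘(ℝ, ℝ).prod (𝓡 n)) (𝓡 n) 2 (uncurry F) (0, q₀)) (h0 : F 0 q₀ = q₀) :
    ContDiffAt ℝ 1 (fun y => fderiv ℝ (coordVariation e F) (0, y) (1, 0)) (e q₀) :=
  ContDiffAt.clm_apply (ContDiffAt.comp (e q₀) (g := fderiv ℝ (coordVariation e F))
    ((contDiffAt_coordVariation he hq₀ hF h0).fderiv_right (by norm_num)) (by fun_prop))
    contDiffAt_const

theorem contDiffWithinAt_momentumPairing (hL : ContMDiff (𝓡 n).tangent 𝓘(ℝ, ℝ) ∞ L)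
    (he : e ∈ IsManifold.maximalAtlas (𝓡 n) ∞ Q) (hab : a < b)
    (hγ : ContMDiffOn 𝓘(ℝ, ℝ) (𝓡 n) 2 γ (Icc a b)) (ht₀ : t₀ ∈ Icc a b)
    (hs : γ t₀ ∈ e.source)
    (hF : ContMDiffAt (𝓘(ℝ, ℝ).prod (𝓡 n)) (𝓡 n) 2 (uncurry F) (0, γ t₀))
    (hid : ∀ᶠ q in 𝓝 (γ t₀), F 0 q = q)
    (hX : ∀ᶠ q in 𝓝 (γ t₀),
      (mfderiv 𝓘(ℝ, ℝ) (𝓡 n) (fun s => F s q) 0 (1 : ℝ) : 𝔼(n)) = X q) :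
    ContDiffWithinAt ℝ 1 (momentumPairing L a b γ X) (Icc a b) t₀ := by
  have hev := momentumPairing_eventuallyEq hL he hab hγ ht₀ hs hF hid hX
  refine ContDiffWithinAt.congr_of_eventuallyEq ?_ hev (hev.self_of_nhdsWithin ht₀)
  exact contDiffWithinAt_momentum_field hab ht₀ (contDiffWithinAt_chart_comp he hγ ht₀ hs)
    (contDiffAt_coordLagrangian_two hL he (e.map_source hs))
    (contDiffAt_variationField he hs hF hid.self_of_nhds)

/-- First variation formula at one time: the derivative of the Lagrangian along a variation is the
Euler–Lagrange covector on the variation field plus the time derivative of its momentum. -/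
theorem hasDerivAt_liftedVariation (hL : ContMDiff (𝓡 n).tangent 𝓘(ℝ, ℝ) ∞ L)
    (he : e ∈ IsManifold.maximalAtlas (𝓡 n) ∞ Q) (hab : a < b)
    (hγ : ContMDiffOn 𝓘(ℝ, ℝ) (𝓡 n) 2 γ (Icc a b)) (ht₀ : t₀ ∈ Icc a b)
    (hs : γ t₀ ∈ e.source)
    (hF : ContMDiffAt (𝓘(ℝ, ℝ).prod (𝓡 n)) (𝓡 n) 2 (uncurry F) (0, γ t₀))
    (hid : ∀ᶠ q in 𝓝 (γ t₀), F 0 q = q)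
    (hX : ∀ᶠ q in 𝓝 (γ t₀),
      (mfderiv 𝓘(ℝ, ℝ) (𝓡 n) (fun s => F s q) 0 (1 : ℝ) : 𝔼(n)) = X q) :
    HasDerivAt (fun s => liftedVariation L a b γ F s t₀)
      (eulerLagrangeResidual (coordLagrangian L e) (fun s => e (γ s)) (Icc a b) t₀
          (mfderiv (𝓡 n) (𝓡 n) e (γ t₀) (X (γ t₀))) +
        derivWithin (momentumPairing L a b γ X) (Icc a b) t₀) 0 := by
  have h0 := hid.self_of_nhds
  have hev := eventually_liftedVariation_eq (L := L) he hab hγ ht₀ hs hF h0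
  have htend : Filter.Tendsto (fun s : ℝ => (s, t₀)) (𝓝 0) (𝓝 0 ×ˢ 𝓝[Icc a b] t₀) :=
    Filter.tendsto_id.prodMk
      (tendsto_nhdsWithin_iff.2 ⟨tendsto_const_nhds, Filter.Eventually.of_forall fun _ => ht₀⟩)
  have hmom := momentumPairing_eventuallyEq hL he hab hγ ht₀ hs hF hid hX
  have h := hasDerivAt_variedLagrangian_eq_residual hab ht₀
    (contDiffWithinAt_chart_comp he hγ ht₀ hs)
    (contDiffAt_coordLagrangian_two hL he (e.map_source hs))
    (contDiffAt_coordVariation he hs hF h0) (eventually_coordVariation_zero hs hid)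
  rw [← hmom.derivWithin_eq (hmom.self_of_nhdsWithin ht₀), fderiv_coordVariation he hs hF h0] at h
  have hXt := hX.self_of_nhds
  have h' := h.congr_of_eventuallyEq (htend.eventually hev)
  refine h'.congr_deriv ?_
  congr 1
  exact congrArg (fun w : 𝔼(n) => eulerLagrangeResidual (coordLagrangian L e) (fun s => e (γ s))
    (Icc a b) t₀ (mfderiv (𝓡 n) (𝓡 n) e (γ t₀) w)) hXt

/-- The derivative of the Lagrangian along a variation exists and is jointly continuous in the
parameter and in time, near parameter `0`. -/
theorem tendsto_deriv_liftedVariation (hL : ContMDiff (𝓡 n).tangent 𝓘(ℝ, ℝ) ∞ L)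
    (hab : a < b)
    (hγ : ContMDiffOn 𝓘(ℝ, ℝ) (𝓡 n) 2 γ (Icc a b)) (ht₀ : t₀ ∈ Icc a b)
    (hF : ContMDiffAt (𝓘(ℝ, ℝ).prod (𝓡 n)) (𝓡 n) 2 (uncurry F) (0, γ t₀))
    (hid : ∀ᶠ q in 𝓝 (γ t₀), F 0 q = q) :
    (∀ᶠ p : ℝ × ℝ in 𝓝 0 ×ˢ 𝓝[Icc a b] t₀,
      DifferentiableAt ℝ (fun s => liftedVariation L a b γ F s p.2) p.1 ∧
      ContinuousWithinAt (fun t => liftedVariation L a b γ F p.1 t) (Icc a b) p.2) ∧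
    Filter.Tendsto (fun p : ℝ × ℝ => deriv (fun s => liftedVariation L a b γ F s p.2) p.1)
      (𝓝 0 ×ˢ 𝓝[Icc a b] t₀) (𝓝 (deriv (fun s => liftedVariation L a b γ F s t₀) 0)) := by
  set e := chartAt 𝔼(n) (γ t₀)
  have he : e ∈ IsManifold.maximalAtlas (𝓡 n) ∞ Q := IsManifold.chart_mem_maximalAtlas _
  have hs : γ t₀ ∈ e.source := mem_chart_source _ _
  have h0 := hid.self_of_nhds
  set H := variedLagrangian (coordLagrangian L e) (coordVariation e F)
  set x : ℝ → 𝔼(n) := fun s => e (γ s)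
  have hx := contDiffWithinAt_chart_comp he hγ ht₀ hs
  have hv := contDiffWithinAt_velocity hab ht₀ hx
  have hH : ContDiffAt ℝ 1 H (0, x t₀, derivWithin x (Icc a b) t₀) :=
    contDiffAt_variedLagrangian (contDiffAt_coordVariation he hs hF h0)
      (eventually_coordVariation_zero hs hid)
      (contDiffAt_coordLagrangian_two hL he (e.map_source hs))
  have hev := eventually_liftedVariation_eq (L := L) he hab hγ ht₀ hs hF h0
  -- a product of two sets on which the coordinate formula holds
  obtain ⟨P, hP, R, hR, hPR⟩ := Filter.eventually_prod_iff.1 hev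
  have htend : Filter.Tendsto (fun p : ℝ × ℝ => (p.1, x p.2, derivWithin x (Icc a b) p.2))
      (𝓝 0 ×ˢ 𝓝[Icc a b] t₀) (𝓝 (0, x t₀, derivWithin x (Icc a b) t₀)) := by
    rw [nhds_prod_eq]
    exact Filter.tendsto_id.prodMap
      (hx.continuousWithinAt.prodMk hv.continuousWithinAt :
        ContinuousWithinAt (fun t => (x t, derivWithin x (Icc a b) t)) (Icc a b) t₀)
  have hHd : ∀ᶠ p : ℝ × ℝ in 𝓝 0 ×ˢ 𝓝[Icc a b] t₀,
      ContDiffAt ℝ 1 H (p.1, x p.2, derivWithin x (Icc a b) p.2) :=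
    htend.eventually (hH.eventually (by simp))
  have hcurve : ∀ᶠ t in 𝓝[Icc a b] t₀, t ∈ Icc a b ∧ ContDiffWithinAt ℝ 2 x (Icc a b) t := by
    filter_upwards [self_mem_nhdsWithin, (hγ t₀ ht₀).continuousWithinAt.eventually
      (e.open_source.mem_nhds hs)] with t h1 h2
    exact ⟨h1, contDiffWithinAt_chart_comp he hγ h1 h2⟩
  have hder : ∀ᶠ p : ℝ × ℝ in 𝓝 0 ×ˢ 𝓝[Icc a b] t₀,
      HasDerivAt (fun s => liftedVariation L a b γ F s p.2)
        (fderiv ℝ H (p.1, x p.2, derivWithin x (Icc a b) p.2) (1, 0)) p.1 := by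
    filter_upwards [hHd, (eventually_eventually_nhds.2 hP).prod_inl (𝓝[Icc a b] t₀),
      hR.prod_inr (𝓝 (0 : ℝ))] with p h1 h2 h3
    have h4 : HasDerivAt (fun s : ℝ => H (s, x p.2, derivWithin x (Icc a b) p.2))
        (fderiv ℝ H (p.1, x p.2, derivWithin x (Icc a b) p.2) (1, 0)) p.1 :=
      HasFDerivAt.comp_hasDerivAt p.1 (l := H)
        (f := fun s => (s, x p.2, derivWithin x (Icc a b) p.2))
        (h1.differentiableAt (by norm_num)).hasFDerivAt
        ((hasDerivAt_id p.1).prodMk (hasDerivAt_const _ _))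
    refine h4.congr_of_eventuallyEq ?_
    filter_upwards [h2] with s hs
    exact hPR hs h3
  have hcont : ∀ᶠ p : ℝ × ℝ in 𝓝 0 ×ˢ 𝓝[Icc a b] t₀,
      ContinuousWithinAt (fun t => liftedVariation L a b γ F p.1 t) (Icc a b) p.2 := by
    have hRR : ∀ᶠ t in 𝓝[Icc a b] t₀, ∀ᶠ τ in 𝓝[Icc a b] t, R τ :=
      eventually_eventually_nhdsWithin.2 hR
    filter_upwards [hHd, hP.prod_inl (𝓝[Icc a b] t₀), hRR.prod_inr (𝓝 (0 : ℝ)),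
      hcurve.prod_inr (𝓝 (0 : ℝ))] with p h1 h2 h3 h4
    have h5 := h4.2.continuousWithinAt
    have h6 := (contDiffWithinAt_velocity hab h4.1 h4.2).continuousWithinAt
    have h7 : ContinuousWithinAt (fun t => H (p.1, x t, derivWithin x (Icc a b) t))
        (Icc a b) p.2 :=
      ContinuousAt.comp_continuousWithinAt (g := H)
        (f := fun t => (p.1, x t, derivWithin x (Icc a b) t)) h1.continuousAt
        (continuousWithinAt_const.prodMk (h5.prodMk h6))
    refine h7.congr_of_eventuallyEq ?_ ?_
    · filter_upwards [h3] with t ht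
      exact hPR h2 ht
    · exact hPR h2 (h3.self_of_nhdsWithin h4.1)
  refine ⟨(hder.and hcont).mono fun p hp => ⟨hp.1.differentiableAt, hp.2⟩, ?_⟩
  have hfc : Filter.Tendsto
      (fun p : ℝ × ℝ => fderiv ℝ H (p.1, x p.2, derivWithin x (Icc a b) p.2) (1, 0))
      (𝓝 0 ×ˢ 𝓝[Icc a b] t₀)
      (𝓝 (fderiv ℝ H (0, x t₀, derivWithin x (Icc a b) t₀) (1, 0))) :=
    (((hH.fderiv_right (m := 0) (by norm_num)).continuousAt.clm_apply
      continuousAt_const).tendsto.comp htend)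
  have hmem : pure ((0 : ℝ), t₀) ≤ 𝓝 (0 : ℝ) ×ˢ 𝓝[Icc a b] t₀ := by
    rw [← Filter.prod_pure_pure]
    exact Filter.prod_mono (pure_le_nhds _) (pure_le_nhdsWithin ht₀)
  have hpt := (hder.filter_mono hmem : ∀ᶠ p in pure ((0 : ℝ), t₀), _)
  rw [Filter.eventually_pure] at hpt
  rw [hpt.deriv]
  exact hfc.congr' (hder.mono fun p hp => hp.deriv.symm)

end LocalFirstVariation

/-! ### Chart independence of the Euler–Lagrange equations -/

section ChartIndependence

variable {n : ℕ} {Q : Type*} [TopologicalSpace Q] [ChartedSpace 𝔼(n) Q] [IsManifold (𝓡 n) ∞ Q]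
  {L : TangentBundle (𝓡 n) Q → ℝ} {e e' : OpenPartialHomeomorph Q 𝔼(n)} {a b : ℝ}
  {γ : ℝ → Q} {t : ℝ}

/-- The Euler–Lagrange expression in a chart vanishes if it vanishes in another chart: both compute
the first variation along the translations of the first chart, up to the same time derivative. -/
theorem eulerLagrangeResidual_eq_zero_of_chart (hL : ContMDiff (𝓡 n).tangent 𝓘(ℝ, ℝ) ∞ L)
    (he : e ∈ IsManifold.maximalAtlas (𝓡 n) ∞ Q) (he' : e' ∈ IsManifold.maximalAtlas (𝓡 n) ∞ Q)
    (hab : a < b) (hγ : ContMDiffOn 𝓘(ℝ, ℝ) (𝓡 n) 2 γ (Icc a b)) (ht : t ∈ Icc a b)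
    (hs : γ t ∈ e.source) (hs' : γ t ∈ e'.source)
    (h : ∀ w, eulerLagrangeResidual (coordLagrangian L e') (fun s => e' (γ s)) (Icc a b) t w = 0)
    (w : 𝔼(n)) :
    eulerLagrangeResidual (coordLagrangian L e) (fun s => e (γ s)) (Icc a b) t w = 0 := by
  have h2 : (2 : WithTop ℕ∞) ≤ ∞ := WithTop.coe_le_coe.2 (le_top : (2 : ℕ∞) ≤ ⊤)
  -- the translations of the chart `e` in the direction `w`, whose velocity is the constant `w`;
  -- away from `e.source` the values are irrelevant
  let F : ℝ → Q → Q := fun s q => e.symm (e q + s • w)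
  let X : ∀ q : Q, TangentSpace (𝓡 n) q := fun q =>
    (mfderiv 𝓘(ℝ, ℝ) (𝓡 n) (fun s => F s q) 0 (1 : ℝ) : 𝔼(n))
  have hF : ContMDiffAt (𝓘(ℝ, ℝ).prod (𝓡 n)) (𝓡 n) 2 (uncurry F) (0, γ t) := by
    have h3 : ContMDiffAt (𝓘(ℝ, ℝ).prod (𝓡 n)) 𝓘(ℝ, 𝔼(n)) 2
        (fun p : ℝ × Q => e p.2 + p.1 • w) (0, γ t) := by
      have h4 : ContMDiffAt (𝓡 n) 𝓘(ℝ, 𝔼(n)) 2 e (γ t) :=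
        ((contMDiffOn_of_mem_maximalAtlas he).contMDiffAt (e.open_source.mem_nhds hs)).of_le h2
      exact (ContMDiffAt.comp (0, γ t) (g := e) h4 contMDiffAt_snd).add
        (contMDiffAt_fst.smul contMDiffAt_const)
    refine ContMDiffAt.comp_of_eq (g := e.symm) (f := fun p : ℝ × Q => e p.2 + p.1 • w)
      (y := e (γ t)) ?_ h3 (by simp)
    exact ((contMDiffOn_symm_of_mem_maximalAtlas he).contMDiffAt
      (e.open_target.mem_nhds (e.map_source hs))).of_le h2
  have hid : ∀ᶠ q in 𝓝 (γ t), F 0 q = q := by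
    filter_upwards [e.open_source.mem_nhds hs] with q hq
    simp [F, e.left_inv hq]
  have hX : ∀ᶠ q in 𝓝 (γ t),
      (mfderiv 𝓘(ℝ, ℝ) (𝓡 n) (fun s => F s q) 0 (1 : ℝ) : 𝔼(n)) = X q :=
    Filter.Eventually.of_forall fun _ => rfl
  have hXw : (mfderiv (𝓡 n) (𝓡 n) e (γ t) (X (γ t)) : 𝔼(n)) = w := by
    refine (fderiv_coordVariation he hs hF hid.self_of_nhds).symm.trans ?_
    have hev : coordVariation e F =ᶠ[𝓝 (0, e (γ t))] fun p => p.2 + p.1 • w := by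
      have hc : Continuous fun p : ℝ × 𝔼(n) => p.2 + p.1 • w := by fun_prop
      have h5 : ∀ᶠ p : ℝ × 𝔼(n) in 𝓝 (0, e (γ t)), p.2 ∈ e.target :=
        continuousAt_snd.eventually (e.open_target.mem_nhds (e.map_source hs))
      have h6 : ∀ᶠ p : ℝ × 𝔼(n) in 𝓝 (0, e (γ t)), p.2 + p.1 • w ∈ e.target :=
        hc.continuousAt.eventually (e.open_target.mem_nhds (by simpa using e.map_source hs))
      filter_upwards [h5, h6] with p hp hp'
      simp only [coordVariation, F]
      rw [e.right_inv hp, e.right_inv hp']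
    rw [hev.fderiv_eq]
    have h7 : HasFDerivAt (fun p : ℝ × 𝔼(n) => p.2 + p.1 • w)
        (ContinuousLinearMap.snd ℝ ℝ 𝔼(n) + (ContinuousLinearMap.fst ℝ ℝ 𝔼(n)).smulRight w)
        (0, e (γ t)) := hasFDerivAt_snd.add (hasFDerivAt_fst.smul_const w)
    rw [h7.fderiv]
    simp
  have k1 := hasDerivAt_liftedVariation hL he hab hγ ht hs hF hid hX
  have k2 := hasDerivAt_liftedVariation hL he' hab hγ ht hs' hF hid hX
  -- the derivatives of the momentum agree, being the same intrinsic function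
  have k3 := add_right_cancel (k1.unique k2)
  exact ((congrArg (eulerLagrangeResidual (coordLagrangian L e) (fun s => e (γ s)) (Icc a b) t)
    hXw).symm.trans k3).trans (h _)

/-- The Euler–Lagrange equations hold in every chart exactly when the residual vanishes in every
chart: the momenta of a `C²` curve are differentiable, so the existence of the time derivative is
automatic. -/
theorem satisfiesEulerLagrange_iff (hL : ContMDiff (𝓡 n).tangent 𝓘(ℝ, ℝ) ∞ L)
    (hab : a < b) (hγ : ContMDiffOn 𝓘(ℝ, ℝ) (𝓡 n) 2 γ (Icc a b)) :
    SatisfiesEulerLagrange L a b γ ↔ ∀ e ∈ IsManifold.maximalAtlas (𝓡 n) ∞ Q, ∀ t ∈ Icc a b,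
      γ t ∈ e.source → ∀ w,
        eulerLagrangeResidual (coordLagrangian L e) (fun s => e (γ s)) (Icc a b) t w = 0 := by
  unfold SatisfiesEulerLagrange
  refine forall₂_congr fun e he => forall₂_congr fun t ht => forall₂_congr fun hs w => ?_
  have hu := uniqueDiffOn_Icc hab t ht
  have hd : ∀ z : 𝔼(n) × 𝔼(n), z.1 ∈ e.target → DifferentiableAt ℝ (coordLagrangian L e) z :=
    fun z hz => (contDiffAt_coordLagrangian hL he hz).differentiableAt (by simp)
  have hfst : ∀ x v w : 𝔼(n), x ∈ e.target →
      fderiv ℝ (fun y => lagrangianInChart L e y v) x w =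
        fderiv ℝ (coordLagrangian L e) (x, v) (w, 0) := fun x v w hx => by
    have := HasFDerivAt.comp x (g := coordLagrangian L e) (f := fun y => (y, v))
      (hd (x, v) hx).hasFDerivAt (hasFDerivAt_prodMk_left (𝕜 := ℝ) x v)
    exact DFunLike.congr_fun this.fderiv w
  have hsnd : ∀ x v w : 𝔼(n), x ∈ e.target →
      fderiv ℝ (fun u => lagrangianInChart L e x u) v w =
        fderiv ℝ (coordLagrangian L e) (x, v) (0, w) := fun x v w hx => by
    have := HasFDerivAt.comp v (g := coordLagrangian L e) (f := fun u => (x, u))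
      (hd (x, v) hx).hasFDerivAt (hasFDerivAt_prodMk_right (𝕜 := ℝ) x v)
    exact DFunLike.congr_fun this.fderiv w
  have hx := contDiffWithinAt_chart_comp he hγ ht hs
  have hdm := differentiableWithinAt_momentum_apply hab ht hx
    (contDiffAt_coordLagrangian_two hL he (e.map_source hs)) w
  have hev : (fun s => fderiv ℝ (fun u => lagrangianInChart L e (e (γ s)) u)
      (derivWithin (fun s => e (γ s)) (Icc a b) s) w) =ᶠ[𝓝[Icc a b] t]
      fun s => fderiv ℝ (coordLagrangian L e)
        (e (γ s), derivWithin (fun s => e (γ s)) (Icc a b) s) (0, w) := by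
    filter_upwards [(hγ t ht).continuousWithinAt.eventually (e.open_source.mem_nhds hs)] with s hs'
    exact hsnd _ _ _ (e.map_source hs')
  rw [hev.hasDerivWithinAt_iff_of_mem ht, hfst _ _ _ (e.map_source hs), eulerLagrangeResidual,
    sub_eq_zero]
  exact ⟨fun h => (h.derivWithin hu).symm, fun h => h ▸ hdm.hasDerivWithinAt⟩

end ChartIndependence

/-! ### The Lagrange equation in natural coordinates -/

section LagrangeEquation

variable {n : ℕ} {Q : Type*} [TopologicalSpace Q] [ChartedSpace 𝔼(n) Q] [IsManifold (𝓡 n) ∞ Q]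
  {L : TangentBundle (𝓡 n) Q → ℝ} {e : OpenPartialHomeomorph Q 𝔼(n)} {a b : ℝ}
  {γ : ℝ → Q} {t : ℝ}

/-- The inclusion of a tangent space in the tangent bundle is differentiable; in natural coordinates
it is `w ↦ (e q, T w)` with `T` linear. -/
theorem mdifferentiable_fibreInclusion (q : Q) :
    MDifferentiable 𝓘(ℝ, 𝔼(n)) (𝓡 n).tangent
      (fun w : 𝔼(n) => (⟨q, w⟩ : TangentBundle (𝓡 n) Q)) := by
  set e := chartAt 𝔼(n) q
  have he : e ∈ IsManifold.maximalAtlas (𝓡 n) ∞ Q := IsManifold.chart_mem_maximalAtlas _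
  have hq : q ∈ e.source := mem_chart_source _ _
  let T : 𝔼(n) →L[ℝ] 𝔼(n) := mfderiv (𝓡 n) (𝓡 n) e q
  have h1 : (fun w : 𝔼(n) => (⟨q, w⟩ : TangentBundle (𝓡 n) Q)) =
      naturalParam e ∘ fun w => (e q, T w) := by
    funext w
    exact mk_eq_naturalParam hq (mfderiv_symm_mfderiv_apply he hq w)
  rw [h1]
  intro w
  have h2 : MDifferentiableAt 𝓘(ℝ, 𝔼(n)) 𝓘(ℝ, 𝔼(n) × 𝔼(n)) (fun w => (e q, T w)) w :=
    ((differentiableAt_const (e q)).prodMk T.differentiableAt).mdifferentiableAt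
  exact MDifferentiableAt.comp w (mdifferentiableAt_naturalParam he (e.map_source hq)) h2

/-- In natural coordinates, the derivative of `L` along a vertical lift is a partial derivative in
the velocities. -/
theorem diff_verticalLift_naturalParam (hL : ContMDiff (𝓡 n).tangent 𝓘(ℝ, ℝ) ∞ L)
    (he : e ∈ IsManifold.maximalAtlas (𝓡 n) ∞ Q) {z : 𝔼(n) × 𝔼(n)} (hz : z.1 ∈ e.target)
    (u : 𝔼(n)) :
    diff (𝓡 n).tangent L (naturalParam e z) (verticalLift (naturalParam e z)
      (mfderiv 𝓘(ℝ, 𝔼(n)) (𝓡 n) e.symm z.1 u)) = fderiv ℝ (coordLagrangian L e) z (0, u) := by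
  let T : 𝔼(n) →L[ℝ] 𝔼(n) := mfderiv 𝓘(ℝ, 𝔼(n)) (𝓡 n) e.symm z.1
  let ι : 𝔼(n) → TangentBundle (𝓡 n) Q := fun w => ⟨e.symm z.1, w⟩
  have hι : MDifferentiableAt 𝓘(ℝ, 𝔼(n)) (𝓡 n).tangent ι (T z.2) :=
    mdifferentiable_fibreInclusion (e.symm z.1) (T z.2)
  have hLd : MDifferentiableAt (𝓡 n).tangent 𝓘(ℝ, ℝ) L (ι (T z.2)) :=
    hL.mdifferentiableAt (by simp)
  have h1 : mfderiv 𝓘(ℝ, 𝔼(n)) 𝓘(ℝ, ℝ) (L ∘ ι) (T z.2) (T u) =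
      diff (𝓡 n).tangent L (naturalParam e z) (verticalLift (naturalParam e z) (T u)) :=
    mfderiv_comp_apply (T z.2) hLd hι (T u)
  have h2 : MDifferentiableAt 𝓘(ℝ, 𝔼(n)) 𝓘(ℝ, ℝ) (L ∘ ι) (T z.2) :=
    MDifferentiableAt.comp (T z.2) hLd hι
  have h3 : HasFDerivAt (L ∘ ι ∘ T) ((fderiv ℝ (L ∘ ι) (T z.2)).comp T) z.2 :=
    HasFDerivAt.comp z.2 (g := L ∘ ι) h2.differentiableAt.hasFDerivAt T.hasFDerivAt
  have h4 : HasFDerivAt (L ∘ ι ∘ T)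
      ((fderiv ℝ (coordLagrangian L e) z).comp (.inr ℝ 𝔼(n) 𝔼(n))) z.2 :=
    HasFDerivAt.comp z.2 (g := coordLagrangian L e) (f := fun u => (z.1, u))
      ((contDiffAt_coordLagrangian hL he hz).differentiableAt (by simp)).hasFDerivAt
      (hasFDerivAt_prodMk_right (𝕜 := ℝ) z.1 z.2)
  refine h1.symm.trans ?_
  rw [mfderiv_eq_fderiv]
  exact DFunLike.congr_fun (h3.unique h4) u

/-- The Cartan form in natural coordinates is `(∂L/∂v) dx`. -/
theorem cartanOneForm_naturalParam (hL : ContMDiff (𝓡 n).tangent 𝓘(ℝ, ℝ) ∞ L)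
    (he : e ∈ IsManifold.maximalAtlas (𝓡 n) ∞ Q) {z : 𝔼(n) × 𝔼(n)} (hz : z.1 ∈ e.target)
    (Y : 𝔼(n) × 𝔼(n)) :
    cartanOneForm L (naturalParam e z)
      (mfderiv 𝓘(ℝ, 𝔼(n) × 𝔼(n)) (𝓡 n).tangent (naturalParam e) z Y) =
      fderiv ℝ (coordLagrangian L e) z (0, Y.1) := by
  rw [← diff_verticalLift_naturalParam hL he hz]
  have hproj : MDifferentiableAt (𝓡 n).tangent (𝓡 n)
      (fun p : TangentBundle (𝓡 n) Q => p.proj) (naturalParam e z) :=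
    (Bundle.contMDiff_proj (n := 1) (TangentSpace (𝓡 n) (M := Q))).mdifferentiableAt (by simp)
  have h1 := mfderiv_comp_apply z hproj (mdifferentiableAt_naturalParam he hz) Y
  have h2 : MDifferentiableAt (𝓡 n) (𝓡 n) e.symm z.1 :=
    mdifferentiableAt_symm_of_mem_maximalAtlas (I := 𝓡 n) (mem_maximalAtlas_one he) hz
  have h3 := mfderiv_comp_apply z (I := 𝓘(ℝ, 𝔼(n) × 𝔼(n))) (f := Prod.fst) h2
    (differentiableAt_fst.mdifferentiableAt) Y
  have h4 : mfderiv 𝓘(ℝ, 𝔼(n) × 𝔼(n)) 𝓘(ℝ, 𝔼(n)) (Prod.fst : 𝔼(n) × 𝔼(n) → 𝔼(n)) z Y = Y.1 := by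
    rw [mfderiv_eq_fderiv, fderiv_fst]
    rfl
  have h5 : (mfderiv (𝓡 n).tangent (𝓡 n) (fun p : TangentBundle (𝓡 n) Q => p.proj)
      (naturalParam e z)
      (mfderiv 𝓘(ℝ, 𝔼(n) × 𝔼(n)) (𝓡 n).tangent (naturalParam e) z Y) : 𝔼(n)) =
      mfderiv 𝓘(ℝ, 𝔼(n)) (𝓡 n) e.symm z.1 Y.1 :=
    h1.symm.trans (h3.trans (congrArg
      (fun w : 𝔼(n) => (mfderiv 𝓘(ℝ, 𝔼(n)) (𝓡 n) e.symm z.1 w : 𝔼(n))) h4))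
  exact congrArg (fun w : 𝔼(n) => diff (𝓡 n).tangent L (naturalParam e z)
    (verticalLift (naturalParam e z) w)) h5

/-- The energy in natural coordinates is `(∂L/∂v) v - L`. -/
theorem energy_naturalParam (hL : ContMDiff (𝓡 n).tangent 𝓘(ℝ, ℝ) ∞ L)
    (he : e ∈ IsManifold.maximalAtlas (𝓡 n) ∞ Q) {z : 𝔼(n) × 𝔼(n)} (hz : z.1 ∈ e.target) :
    energy L (naturalParam e z) =
      fderiv ℝ (coordLagrangian L e) z (0, z.2) - coordLagrangian L e z := by
  rw [← diff_verticalLift_naturalParam hL he hz]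
  rfl

/-- Derivative of the coordinate expression of the energy. -/
theorem hasFDerivAt_coordEnergy {V : Type*} [NormedAddCommGroup V] [NormedSpace ℝ V]
    {Λ : V × V → ℝ} {z : V × V} (hΛ : ContDiffAt ℝ 2 Λ z) :
    ∃ D : V × V →L[ℝ] ℝ, HasFDerivAt (fun z => fderiv ℝ Λ z (0, z.2) - Λ z) D z ∧
      ∀ Y, D Y = fderiv ℝ (fderiv ℝ Λ) z Y (0, z.2) - fderiv ℝ Λ z (Y.1, 0) := by
  have h1 : HasFDerivAt (fderiv ℝ Λ) (fderiv ℝ (fderiv ℝ Λ) z) z :=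
    ((hΛ.fderiv_right (m := 1) (by norm_num)).differentiableAt (by norm_num)).hasFDerivAt
  have h2 : HasFDerivAt (fun z : V × V => ((0 : V), z.2))
      ((ContinuousLinearMap.inr ℝ V V).comp (.snd ℝ V V)) z :=
    ((ContinuousLinearMap.inr ℝ V V).comp (.snd ℝ V V)).hasFDerivAt
  have h3 := (h1.clm_apply h2).fun_sub (hΛ.differentiableAt (by norm_num)).hasFDerivAt
  refine ⟨_, h3, fun Y => ?_⟩
  have h4 : fderiv ℝ Λ z Y = fderiv ℝ Λ z (Y.1, 0) + fderiv ℝ Λ z (0, Y.2) := by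
    rw [← map_add]
    simp
  simp only [sub_apply, add_apply,
    ContinuousLinearMap.comp_apply, ContinuousLinearMap.flip_apply, h4]
  simp
  ring

/-- The time derivative of `(∂Λ/∂v) · w`, by the chain rule along the curve `(x, x')`. -/
theorem derivWithin_momentum {V : Type*} [NormedAddCommGroup V] [NormedSpace ℝ V]
    {Λ : V × V → ℝ} {x : ℝ → V} (hab : a < b) (ht : t ∈ Icc a b)
    (hx : ContDiffWithinAt ℝ 2 x (Icc a b) t)
    (hΛ : ContDiffAt ℝ 2 Λ (x t, derivWithin x (Icc a b) t)) (w : V) :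
    derivWithin (fun s => fderiv ℝ Λ (x s, derivWithin x (Icc a b) s) (0, w)) (Icc a b) t =
      fderiv ℝ (fderiv ℝ Λ) (x t, derivWithin x (Icc a b) t)
        (derivWithin (fun s => (x s, derivWithin x (Icc a b) s)) (Icc a b) t) (0, w) := by
  have h1 : HasFDerivAt (fderiv ℝ Λ) _ (x t, derivWithin x (Icc a b) t) :=
    ((hΛ.fderiv_right (m := 1) (by norm_num)).differentiableAt (by norm_num)).hasFDerivAt
  have h2 : DifferentiableWithinAt ℝ (fun s => (x s, derivWithin x (Icc a b) s)) (Icc a b) t :=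
    (hx.differentiableWithinAt (by norm_num)).prodMk
      ((contDiffWithinAt_velocity hab ht hx).differentiableWithinAt (by norm_num))
  have h3 := (HasFDerivAt.comp_hasDerivWithinAt t (l := fderiv ℝ Λ) h1
    h2.hasDerivWithinAt).clm_apply (hasDerivWithinAt_const t (Icc a b) ((0 : V), w))
  have h4 := h3.derivWithin (uniqueDiffOn_Icc hab t ht)
  rw [map_zero, add_zero] at h4
  exact h4

/-- In natural coordinates, `dΘ_L (X, Y) = D(∂L/∂v)(X) · Y₁ - D(∂L/∂v)(Y) · X₁`, where
the index `1` denotes the position component of a vector. -/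
theorem extDerivOneForm_cartanOneForm (hL : ContMDiff (𝓡 n).tangent 𝓘(ℝ, ℝ) ∞ L)
    (p : TangentBundle (𝓡 n) Q) (X Y : TangentSpace (𝓡 n).tangent p) :
    extDerivOneForm (𝓡 n).tangent (cartanOneForm L) p X Y =
      fderiv ℝ (fderiv ℝ (coordLagrangian L (chartAt 𝔼(n) p.proj)))
          (extChartAt (𝓡 n).tangent p p)
          (mfderiv (𝓡 n).tangent 𝓘(ℝ, 𝔼(n) × 𝔼(n)) (extChartAt (𝓡 n).tangent p) p X)
          (0, (mfderiv (𝓡 n).tangent 𝓘(ℝ, 𝔼(n) × 𝔼(n)) (extChartAt (𝓡 n).tangent p) p Y :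
            𝔼(n) × 𝔼(n)).1) -
        fderiv ℝ (fderiv ℝ (coordLagrangian L (chartAt 𝔼(n) p.proj)))
          (extChartAt (𝓡 n).tangent p p)
          (mfderiv (𝓡 n).tangent 𝓘(ℝ, 𝔼(n) × 𝔼(n)) (extChartAt (𝓡 n).tangent p) p Y)
          (0, (mfderiv (𝓡 n).tangent 𝓘(ℝ, 𝔼(n) × 𝔼(n)) (extChartAt (𝓡 n).tangent p) p X :
            𝔼(n) × 𝔼(n)).1) := by
  set e := chartAt 𝔼(n) p.proj
  have he : e ∈ IsManifold.maximalAtlas (𝓡 n) ∞ Q := IsManifold.chart_mem_maximalAtlas _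
  have hsrc : p.proj ∈ e.source := mem_chart_source _ _
  set z₀ := extChartAt (𝓡 n).tangent p p with hz₀
  have hz₀t : z₀.1 ∈ e.target := by
    rw [hz₀, extChartAt_tangent_apply hsrc]
    exact e.map_source hsrc
  have hopen : ∀ᶠ z : 𝔼(n) × 𝔼(n) in 𝓝 z₀, z.1 ∈ e.target :=
    continuousAt_fst.eventually (e.open_target.mem_nhds hz₀t)
  let K : 𝔼(n) × 𝔼(n) →L[ℝ] 𝔼(n) × 𝔼(n) :=
    (ContinuousLinearMap.inr ℝ 𝔼(n) 𝔼(n)).comp (.fst ℝ 𝔼(n) 𝔼(n))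
  have hform : formInChart (𝓡 n).tangent (cartanOneForm L) p =ᶠ[𝓝 z₀]
      fun z => (fderiv ℝ (coordLagrangian L e) z).comp K := by
    filter_upwards [hopen.eventually_nhds] with z hz
    have hsymm : (extChartAt (𝓡 n).tangent p).symm =ᶠ[𝓝 z] naturalParam e := by
      filter_upwards [hz] with y hy
      exact extChartAt_tangent_symm_eq p hy
    refine ContinuousLinearMap.ext fun Y => ?_
    refine Eq.trans ?_ (cartanOneForm_naturalParam hL he hz.self_of_nhds Y)
    change cartanOneForm L ((extChartAt (𝓡 n).tangent p).symm z)
      (mfderiv 𝓘(ℝ, 𝔼(n) × 𝔼(n)) (𝓡 n).tangent (extChartAt (𝓡 n).tangent p).symm z Y) = _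
    rw [hsymm.mfderiv_eq, hsymm.self_of_nhds]
  have hfd : DifferentiableAt ℝ (fderiv ℝ (coordLagrangian L e)) z₀ :=
    ((contDiffAt_coordLagrangian_two hL he hz₀t).fderiv_right (m := 1)
      (by norm_num)).differentiableAt (by norm_num)
  have hD : ∀ X' Y' : 𝔼(n) × 𝔼(n),
      fderiv ℝ (formInChart (𝓡 n).tangent (cartanOneForm L) p) z₀ X' Y' =
        fderiv ℝ (fderiv ℝ (coordLagrangian L e)) z₀ X' (0, Y'.1) := by
    intro X' Y'
    rw [hform.fderiv_eq, (hfd.hasFDerivAt.clm_comp (hasFDerivAt_const K z₀)).fderiv]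
    simp [K]
  exact congrArg₂ (· - ·) (hD _ _) (hD _ _)

theorem fst_extChartAt_tangent_mem_target (p : TangentBundle (𝓡 n) Q) :
    (extChartAt (𝓡 n).tangent p p : 𝔼(n) × 𝔼(n)).1 ∈ (chartAt 𝔼(n) p.proj).target := by
  rw [extChartAt_tangent_apply (mem_chart_source _ _)]
  exact (chartAt 𝔼(n) p.proj).map_source (mem_chart_source _ _)

theorem eventually_naturalParam_extChartAt_tangent (p : TangentBundle (𝓡 n) Q) :
    ∀ᶠ q in 𝓝 p, naturalParam (chartAt 𝔼(n) p.proj) (extChartAt (𝓡 n).tangent p q) = q := by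
  have h1 : ∀ᶠ q in 𝓝 p, q ∈ (extChartAt (𝓡 n).tangent p).source :=
    extChartAt_source_mem_nhds p
  have h2 : ∀ᶠ q : TangentBundle (𝓡 n) Q in 𝓝 p, q.proj ∈ (chartAt 𝔼(n) p.proj).source :=
    (FiberBundle.continuous_proj 𝔼(n) (TangentSpace (𝓡 n) (M := Q))).continuousAt.eventually
      ((chartAt 𝔼(n) p.proj).open_source.mem_nhds (mem_chart_source _ _))
  filter_upwards [h1, h2] with q hq hq'
  rw [← extChartAt_tangent_symm_eq p, (extChartAt (𝓡 n).tangent p).left_inv hq]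
  rw [extChartAt_tangent_apply hq']
  exact (chartAt 𝔼(n) p.proj).map_source hq'

/-- In natural coordinates, `dE_L (Y) = D(∂L/∂v)(Y) · v - (∂L/∂x) · Y₁`: the terms
`(∂L/∂v) · Y₂` cancel. -/
theorem diff_energy_apply (hL : ContMDiff (𝓡 n).tangent 𝓘(ℝ, ℝ) ∞ L)
    (p : TangentBundle (𝓡 n) Q) (Y : TangentSpace (𝓡 n).tangent p) :
    diff (𝓡 n).tangent (energy L) p Y =
      fderiv ℝ (fderiv ℝ (coordLagrangian L (chartAt 𝔼(n) p.proj)))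
          (extChartAt (𝓡 n).tangent p p)
          (mfderiv (𝓡 n).tangent 𝓘(ℝ, 𝔼(n) × 𝔼(n)) (extChartAt (𝓡 n).tangent p) p Y)
          (0, (extChartAt (𝓡 n).tangent p p : 𝔼(n) × 𝔼(n)).2) -
        fderiv ℝ (coordLagrangian L (chartAt 𝔼(n) p.proj)) (extChartAt (𝓡 n).tangent p p)
          ((mfderiv (𝓡 n).tangent 𝓘(ℝ, 𝔼(n) × 𝔼(n)) (extChartAt (𝓡 n).tangent p) p Y :
            𝔼(n) × 𝔼(n)).1, 0) := by
  set e := chartAt 𝔼(n) p.proj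
  have he : e ∈ IsManifold.maximalAtlas (𝓡 n) ∞ Q := IsManifold.chart_mem_maximalAtlas _
  have hz₀t := fst_extChartAt_tangent_mem_target p
  obtain ⟨D, hD, hDY⟩ := hasFDerivAt_coordEnergy (contDiffAt_coordLagrangian_two hL he hz₀t)
  have hopen : ∀ᶠ z : 𝔼(n) × 𝔼(n) in 𝓝 (extChartAt (𝓡 n).tangent p p), z.1 ∈ e.target :=
    continuousAt_fst.eventually (e.open_target.mem_nhds hz₀t)
  have h1 : HasFDerivAt (fun z => energy L (naturalParam e z)) D
      (extChartAt (𝓡 n).tangent p p) :=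
    hD.congr_of_eventuallyEq (hopen.mono fun z hz => energy_naturalParam hL he hz)
  have h2 : MDifferentiableAt (𝓡 n).tangent 𝓘(ℝ, 𝔼(n) × 𝔼(n)) (extChartAt (𝓡 n).tangent p) p :=
    mdifferentiableAt_extChartAt (mem_chart_source _ _)
  have h3 : energy L =ᶠ[𝓝 p]
      (fun z => energy L (naturalParam e z)) ∘ extChartAt (𝓡 n).tangent p := by
    filter_upwards [eventually_naturalParam_extChartAt_tangent p] with q hq
    simp only [comp, e]
    rw [hq]
  have h4 := mfderiv_comp_apply p (I' := 𝓘(ℝ, 𝔼(n) × 𝔼(n))) (I'' := 𝓘(ℝ, ℝ))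
    (g := fun z => energy L (naturalParam e z)) h1.differentiableAt.mdifferentiableAt h2 Y
  rw [diff, h3.mfderiv_eq]
  refine h4.trans ?_
  rw [mfderiv_eq_fderiv, h1.fderiv]
  exact hDY _

/-- The velocity of the canonical lift in natural coordinates is the derivative of `(x, x')`. -/
theorem mfderiv_extChartAt_canonicalLiftVelocity (hab : a < b)
    (hγ : ContMDiffOn 𝓘(ℝ, ℝ) (𝓡 n) 2 γ (Icc a b)) (ht : t ∈ Icc a b) :
    (mfderiv (𝓡 n).tangent 𝓘(ℝ, 𝔼(n) × 𝔼(n))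
        (extChartAt (𝓡 n).tangent (canonicalLift (n := n) a b γ t))
        (canonicalLift (n := n) a b γ t) (canonicalLiftVelocity a b γ t) : 𝔼(n) × 𝔼(n)) =
      derivWithin (fun s => (chartAt 𝔼(n) (γ t) (γ s),
        derivWithin (fun s => chartAt 𝔼(n) (γ t) (γ s)) (Icc a b) s)) (Icc a b) t := by
  set e := chartAt 𝔼(n) (γ t)
  have he : e ∈ IsManifold.maximalAtlas (𝓡 n) ∞ Q := IsManifold.chart_mem_maximalAtlas _
  have hs : γ t ∈ e.source := mem_chart_source _ _
  set x : ℝ → 𝔼(n) := fun s => e (γ s)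
  set p := canonicalLift (n := n) a b γ t
  have hx := contDiffWithinAt_chart_comp he hγ ht hs
  have hz : DifferentiableWithinAt ℝ (fun s => (x s, derivWithin x (Icc a b) s)) (Icc a b) t :=
    (hx.differentiableWithinAt (by norm_num)).prodMk
      ((contDiffWithinAt_velocity hab ht hx).differentiableWithinAt (by norm_num))
  have hlift : canonicalLift (n := n) a b γ =ᶠ[𝓝[Icc a b] t]
      naturalParam e ∘ fun s => (x s, derivWithin x (Icc a b) s) := by
    filter_upwards [self_mem_nhdsWithin, (hγ t ht).continuousWithinAt.eventually
      (e.open_source.mem_nhds hs)] with s h1 h2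
    exact canonicalLift_eq_naturalParam he hab h1 h2 ((hγ s h1).mdifferentiableWithinAt (by simp))
  have hext : extChartAt (𝓡 n).tangent p ∘ canonicalLift (n := n) a b γ =ᶠ[𝓝[Icc a b] t]
      fun s => (x s, derivWithin x (Icc a b) s) := by
    filter_upwards [hlift, (hγ t ht).continuousWithinAt.eventually
      (e.open_source.mem_nhds hs)] with s h1 h2
    have h3 : (naturalParam e (x s, derivWithin x (Icc a b) s)).proj ∈ e.source :=
      e.map_target (e.map_source h2)
    rw [comp, h1, comp]
    refine (extChartAt_tangent_apply (p := p) h3).trans ?_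
    refine Prod.ext (e.right_inv (e.map_source h2)) ?_
    exact mfderiv_mfderiv_symm_apply he (e.map_source h2) _
  have hd : MDifferentiableWithinAt 𝓘(ℝ, ℝ) (𝓡 n).tangent (canonicalLift (n := n) a b γ)
      (Icc a b) t := by
    refine MDifferentiableWithinAt.congr_of_eventuallyEq ?_ hlift (hlift.self_of_nhdsWithin ht)
    exact MDifferentiableAt.comp_mdifferentiableWithinAt t
      (mdifferentiableAt_naturalParam he (e.map_source hs)) hz.mdifferentiableWithinAt
  have h2 : MDifferentiableAt (𝓡 n).tangent 𝓘(ℝ, 𝔼(n) × 𝔼(n)) (extChartAt (𝓡 n).tangent p) p :=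
    mdifferentiableAt_extChartAt (mem_chart_source _ _)
  have hu : UniqueMDiffWithinAt 𝓘(ℝ, ℝ) (Icc a b) t :=
    (uniqueDiffOn_Icc hab t ht).uniqueMDiffWithinAt
  have h3 := (HasMFDerivAt.comp_hasMFDerivWithinAt t (g := extChartAt (𝓡 n).tangent p)
    h2.hasMFDerivAt hd.hasMFDerivWithinAt).mfderivWithin hu
  have h4 := congrArg (fun A : ℝ →L[ℝ] 𝔼(n) × 𝔼(n) => A 1) h3
  refine h4.symm.trans ?_
  change (mfderivWithin 𝓘(ℝ, ℝ) 𝓘(ℝ, 𝔼(n) × 𝔼(n))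
    (extChartAt (𝓡 n).tangent p ∘ canonicalLift (n := n) a b γ) (Icc a b) t : ℝ →L[ℝ] _) 1 = _
  rw [mfderivWithin_eq_fderivWithin, hext.fderivWithin_eq (hext.self_of_nhdsWithin ht)]
  rfl

/-- At each time, the geometric equation `i(γ̃') Ω_L = dE_L` is the Euler–Lagrange equation in the
chart of the atlas around `γ t`. -/
theorem lagrangeEquation_iff (hL : ContMDiff (𝓡 n).tangent 𝓘(ℝ, ℝ) ∞ L) (hab : a < b)
    (hγ : ContMDiffOn 𝓘(ℝ, ℝ) (𝓡 n) 2 γ (Icc a b)) (ht : t ∈ Icc a b) :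
    (∀ Y : TangentSpace (𝓡 n).tangent (canonicalLift (n := n) a b γ t),
      cartanTwoForm L (canonicalLift a b γ t) (canonicalLiftVelocity a b γ t) Y =
        diff (𝓡 n).tangent (energy L) (canonicalLift a b γ t) Y) ↔
    ∀ w, eulerLagrangeResidual (coordLagrangian L (chartAt 𝔼(n) (γ t)))
      (fun s => chartAt 𝔼(n) (γ t) (γ s)) (Icc a b) t w = 0 := by
  set e := chartAt 𝔼(n) (γ t)
  have he : e ∈ IsManifold.maximalAtlas (𝓡 n) ∞ Q := IsManifold.chart_mem_maximalAtlas _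
  have hs : γ t ∈ e.source := mem_chart_source _ _
  set x : ℝ → 𝔼(n) := fun s => e (γ s)
  set p := canonicalLift (n := n) a b γ t
  have hx := contDiffWithinAt_chart_comp he hγ ht hs
  have hΛ : ContDiffAt ℝ 2 (coordLagrangian L e) (x t, derivWithin x (Icc a b) t) :=
    contDiffAt_coordLagrangian_two hL he (e.map_source hs)
  have hz₀ : (extChartAt (𝓡 n).tangent p p : 𝔼(n) × 𝔼(n)) = (x t, derivWithin x (Icc a b) t) := by
    have h1 := canonicalLift_eq_naturalParam he hab ht hs
      ((hγ t ht).mdifferentiableWithinAt (by simp))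
    have h3 : (naturalParam e (x t, derivWithin x (Icc a b) t)).proj ∈ e.source :=
      e.map_target (e.map_source hs)
    have h4 := extChartAt_tangent_apply (p := p) h3
    rw [← h1] at h4
    refine h4.trans ?_
    rw [h1]
    exact Prod.ext (e.right_inv (e.map_source hs))
      (mfderiv_mfderiv_symm_apply he (e.map_source hs) _)
  have hX := mfderiv_extChartAt_canonicalLiftVelocity hab hγ ht
  -- the lift is a second-order curve: the position component of its velocity is its velocity
  -- coordinate, which makes the second derivatives of `L` along `Y` cancel in the equation
  have hX1 : (derivWithin (fun s => (x s, derivWithin x (Icc a b) s)) (Icc a b) t).1 =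
      derivWithin x (Icc a b) t := by
    have h := (hx.differentiableWithinAt (by norm_num)).hasDerivWithinAt.prodMk
      ((contDiffWithinAt_velocity hab ht hx).differentiableWithinAt
        (by norm_num)).hasDerivWithinAt
    rw [h.derivWithin (uniqueDiffOn_Icc hab t ht)]
  let C : 𝔼(n) × 𝔼(n) → 𝔼(n) × 𝔼(n) := fun Y =>
    mfderiv (𝓡 n).tangent 𝓘(ℝ, 𝔼(n) × 𝔼(n)) (extChartAt (𝓡 n).tangent p) p Y
  have key : ∀ Y : TangentSpace (𝓡 n).tangent p,
      (cartanTwoForm L p (canonicalLiftVelocity a b γ t) Y =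
        diff (𝓡 n).tangent (energy L) p Y) ↔
      eulerLagrangeResidual (coordLagrangian L e) x (Icc a b) t (C Y).1 = 0 := by
    intro Y
    have hres : eulerLagrangeResidual (coordLagrangian L e) x (Icc a b) t (C Y).1 =
        fderiv ℝ (coordLagrangian L e) (x t, derivWithin x (Icc a b) t) ((C Y).1, 0) -
        fderiv ℝ (fderiv ℝ (coordLagrangian L e)) (x t, derivWithin x (Icc a b) t)
          (derivWithin (fun s => (x s, derivWithin x (Icc a b) s)) (Icc a b) t) (0, (C Y).1) := by
      rw [eulerLagrangeResidual, derivWithin_momentum hab ht hx hΛ]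
    have h1 := extDerivOneForm_cartanOneForm hL p (canonicalLiftVelocity a b γ t) Y
    have h2 := diff_energy_apply hL p Y
    rw [hX] at h1
    change extDerivOneForm (𝓡 n).tangent (cartanOneForm L) p (canonicalLiftVelocity a b γ t) Y =
      fderiv ℝ (fderiv ℝ (coordLagrangian L e)) (extChartAt (𝓡 n).tangent p p)
        (derivWithin (fun s => (x s, derivWithin x (Icc a b) s)) (Icc a b) t) (0, (C Y).1) -
      fderiv ℝ (fderiv ℝ (coordLagrangian L e)) (extChartAt (𝓡 n).tangent p p) (C Y)
        (0, (derivWithin (fun s => (x s, derivWithin x (Icc a b) s)) (Icc a b) t).1) at h1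
    change diff (𝓡 n).tangent (energy L) p Y =
      fderiv ℝ (fderiv ℝ (coordLagrangian L e)) (extChartAt (𝓡 n).tangent p p) (C Y)
        (0, (extChartAt (𝓡 n).tangent p p : 𝔼(n) × 𝔼(n)).2) -
      fderiv ℝ (coordLagrangian L e) (extChartAt (𝓡 n).tangent p p) ((C Y).1, 0) at h2
    rw [hX1, hz₀] at h1
    rw [hz₀] at h2
    rw [cartanTwoForm, h1, h2, hres]
    constructor <;> intro h <;> linarith
  constructor
  · intro h w
    obtain ⟨Y, hY⟩ : ∃ Y : TangentSpace (𝓡 n).tangent p, C Y = (w, 0) :=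
      (isInvertible_mfderiv_extChartAt (I := (𝓡 n).tangent)
        (mem_extChartAt_source p)).bijective.surjective ((w, 0) : 𝔼(n) × 𝔼(n))
    have := (key Y).1 (h Y)
    rwa [hY] at this
  · exact fun h Y => (key Y).2 (h _)

/-- The geometric equation is tested in the chart of the atlas at `γ t` only; chart independence
extends it to all charts. -/
theorem satisfiesLagrangeEquation_iff (hL : ContMDiff (𝓡 n).tangent 𝓘(ℝ, ℝ) ∞ L)
    (hab : a < b) (hγ : ContMDiffOn 𝓘(ℝ, ℝ) (𝓡 n) 2 γ (Icc a b)) :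
    SatisfiesLagrangeEquation L a b γ ↔ ∀ e ∈ IsManifold.maximalAtlas (𝓡 n) ∞ Q, ∀ t ∈ Icc a b,
      γ t ∈ e.source → ∀ w,
        eulerLagrangeResidual (coordLagrangian L e) (fun s => e (γ s)) (Icc a b) t w = 0 := by
  constructor
  · intro h e he t ht hs
    exact eulerLagrangeResidual_eq_zero_of_chart hL he (IsManifold.chart_mem_maximalAtlas _)
      hab hγ ht hs (mem_chart_source _ _) ((lagrangeEquation_iff hL hab hγ ht).1 (h t ht))
  · intro h t ht
    exact (lagrangeEquation_iff hL hab hγ ht).2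
      (h _ (IsManifold.chart_mem_maximalAtlas _) t ht (mem_chart_source _ _))

end LagrangeEquation

/-! ### The first variation of the action -/

section FirstVariation

variable {n : ℕ} {Q : Type*} [TopologicalSpace Q] [ChartedSpace 𝔼(n) Q] [IsManifold (𝓡 n) ∞ Q]
  {L : TangentBundle (𝓡 n) Q → ℝ} {a b : ℝ} {γ : ℝ → Q} {F : ℝ → Q → Q}
  {X : ∀ q : Q, TangentSpace (𝓡 n) q}

theorem continuousOn_deriv_liftedVariation (hL : ContMDiff (𝓡 n).tangent 𝓘(ℝ, ℝ) ∞ L)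
    (hab : a < b) (hγ : ContMDiffOn 𝓘(ℝ, ℝ) (𝓡 n) 2 γ (Icc a b))
    (hF : ∀ t ∈ Icc a b,
      ContMDiffAt (𝓘(ℝ, ℝ).prod (𝓡 n)) (𝓡 n) 2 (uncurry F) (0, γ t))
    (hid : ∀ t ∈ Icc a b, ∀ᶠ q in 𝓝 (γ t), F 0 q = q) :
    ContinuousOn (fun t => deriv (fun s => liftedVariation L a b γ F s t) 0) (Icc a b) := by
  intro t₀ ht₀
  have h := (tendsto_deriv_liftedVariation hL hab hγ ht₀ (hF t₀ ht₀) (hid t₀ ht₀)).2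
  exact h.comp (tendsto_const_nhds.prodMk Filter.tendsto_id)

/-- Differentiation of the action under the integral sign. -/
theorem hasDerivAt_action (hL : ContMDiff (𝓡 n).tangent 𝓘(ℝ, ℝ) ∞ L)
    (hab : a < b) (hγ : ContMDiffOn 𝓘(ℝ, ℝ) (𝓡 n) 2 γ (Icc a b))
    (hF : ∀ t ∈ Icc a b,
      ContMDiffAt (𝓘(ℝ, ℝ).prod (𝓡 n)) (𝓡 n) 2 (uncurry F) (0, γ t))
    (hid : ∀ t ∈ Icc a b, ∀ᶠ q in 𝓝 (γ t), F 0 q = q) :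
    HasDerivAt (fun s => action L a b (fun t => F s (γ t)))
      (∫ t in a..b, deriv (fun s => liftedVariation L a b γ F s t) 0) 0 := by
  set g := liftedVariation L a b γ F
  have hcont := continuousOn_deriv_liftedVariation hL hab hγ hF hid
  -- by compactness of `[a, b]`, a neighbourhood of the parameter `0` that is uniform in time
  have hunif : ∀ᶠ s : ℝ in 𝓝 0, ∀ t ∈ Icc a b, t ∈ Icc a b →
      (DifferentiableAt ℝ (fun s => g s t) s ∧
        ContinuousWithinAt (fun t => g s t) (Icc a b) t) ∧
      ‖deriv (fun s => g s t) s - deriv (fun s => g s t) 0‖ < 1 := by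
    refine isCompact_Icc.eventually_forall_of_forall_eventually
      (P := fun s t => t ∈ Icc a b → (DifferentiableAt ℝ (fun s => g s t) s ∧
        ContinuousWithinAt (fun t => g s t) (Icc a b) t) ∧
      ‖deriv (fun s => g s t) s - deriv (fun s => g s t) 0‖ < 1) fun t₀ ht₀ => ?_
    obtain ⟨h1, h2⟩ := tendsto_deriv_liftedVariation hL hab hγ ht₀ (hF t₀ ht₀) (hid t₀ ht₀)
    have h3 : Filter.Tendsto (fun p : ℝ × ℝ => deriv (fun s => g s p.2) 0)
        (𝓝 0 ×ˢ 𝓝[Icc a b] t₀) (𝓝 (deriv (fun s => g s t₀) 0)) :=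
      (hcont t₀ ht₀).tendsto.comp Filter.tendsto_snd
    have h4 : Filter.Tendsto
        (fun p : ℝ × ℝ => ‖deriv (fun s => g s p.2) p.1 - deriv (fun s => g s p.2) 0‖)
        (𝓝 0 ×ˢ 𝓝[Icc a b] t₀) (𝓝 0) := by
      have h := (h2.sub h3).norm
      rwa [show deriv (fun s => liftedVariation L a b γ F s t₀) 0 - deriv (fun s => g s t₀) 0 = 0
        from sub_self _, norm_zero] at h
    have h5 := h1.and (h4.eventually (gt_mem_nhds one_pos))
    have h6 : 𝓝 (0 : ℝ) ×ˢ 𝓝[Icc a b] t₀ = 𝓝[univ ×ˢ Icc a b] (0, t₀) := by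
      rw [nhdsWithin_prod_eq, nhdsWithin_univ]
    rw [h6, eventually_nhdsWithin_iff] at h5
    filter_upwards [h5] with p hp hp'
    exact hp ⟨mem_univ _, hp'⟩
  have hgc : ∀ᶠ s : ℝ in 𝓝 0, ContinuousOn (g s) (Icc a b) := by
    filter_upwards [hunif] with s hs t ht
    exact (hs t ht ht).1.2
  have hsub : uIoc a b ⊆ Icc a b := by
    rw [uIoc_of_le hab.le]
    exact Ioc_subset_Icc_self
  have hmeas : ∀ {h : ℝ → ℝ}, ContinuousOn h (Icc a b) →
      AEStronglyMeasurable h (volume.restrict (uIoc a b)) := fun hh =>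
    (hh.aestronglyMeasurable measurableSet_Icc).mono_measure (Measure.restrict_mono hsub le_rfl)
  have hint : ∀ {h : ℝ → ℝ}, ContinuousOn h (Icc a b) → IntervalIntegrable h volume a b :=
    fun hh => ContinuousOn.intervalIntegrable (by rwa [uIcc_of_le hab.le])
  refine (intervalIntegral.hasDerivAt_integral_of_dominated_loc_of_deriv_le (F := g)
    (F' := fun s t => deriv (fun s => g s t) s)
    (bound := fun t => ‖deriv (fun s => g s t) 0‖ + 1) hunif ?_ ?_ ?_ ?_ ?_ ?_).2
  · exact hgc.mono fun s hs => hmeas hs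
  · exact hint hgc.self_of_nhds
  · exact hmeas hcont
  · refine Filter.Eventually.of_forall fun t ht s hs => ?_
    have h1 := (hs t (hsub ht) (hsub ht)).2
    have h2 := norm_sub_norm_le (deriv (fun s => g s t) s) (deriv (fun s => g s t) 0)
    linarith
  · exact hint (hcont.norm.add continuousOn_const)
  · refine Filter.Eventually.of_forall fun t ht s hs => ?_
    exact (hs t (hsub ht) (hsub ht)).1.1.hasDerivAt

theorem contDiffOn_momentumPairing (hL : ContMDiff (𝓡 n).tangent 𝓘(ℝ, ℝ) ∞ L)
    (hab : a < b) (hγ : ContMDiffOn 𝓘(ℝ, ℝ) (𝓡 n) 2 γ (Icc a b))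
    (hF : ∀ t ∈ Icc a b,
      ContMDiffAt (𝓘(ℝ, ℝ).prod (𝓡 n)) (𝓡 n) 2 (uncurry F) (0, γ t))
    (hid : ∀ t ∈ Icc a b, ∀ᶠ q in 𝓝 (γ t), F 0 q = q)
    (hX : ∀ t ∈ Icc a b, ∀ᶠ q in 𝓝 (γ t),
      (mfderiv 𝓘(ℝ, ℝ) (𝓡 n) (fun s => F s q) 0 (1 : ℝ) : 𝔼(n)) = X q) :
    ContDiffOn ℝ 1 (momentumPairing L a b γ X) (Icc a b) := fun t ht =>
  contDiffWithinAt_momentumPairing hL (IsManifold.chart_mem_maximalAtlas (γ t)) hab hγ ht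
    (mem_chart_source _ _) (hF t ht) (hid t ht) (hX t ht)

theorem momentumPairing_eq_zero {t : ℝ} (h : X (γ t) = 0) : momentumPairing L a b γ X t = 0 := by
  simp [momentumPairing, h]

/-- First variation formula: if the variation field vanishes at the end points, the boundary term
drops out, and the derivative of the action is the integral of the Euler–Lagrange part. -/
theorem integral_deriv_liftedVariation (hL : ContMDiff (𝓡 n).tangent 𝓘(ℝ, ℝ) ∞ L)
    (hab : a < b) (hγ : ContMDiffOn 𝓘(ℝ, ℝ) (𝓡 n) 2 γ (Icc a b))
    (hF : ∀ t ∈ Icc a b,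
      ContMDiffAt (𝓘(ℝ, ℝ).prod (𝓡 n)) (𝓡 n) 2 (uncurry F) (0, γ t))
    (hid : ∀ t ∈ Icc a b, ∀ᶠ q in 𝓝 (γ t), F 0 q = q)
    (hX : ∀ t ∈ Icc a b, ∀ᶠ q in 𝓝 (γ t),
      (mfderiv 𝓘(ℝ, ℝ) (𝓡 n) (fun s => F s q) 0 (1 : ℝ) : 𝔼(n)) = X q)
    (ha : X (γ a) = 0) (hb : X (γ b) = 0) :
    ContinuousOn (fun t => deriv (fun s => liftedVariation L a b γ F s t) 0 -
      derivWithin (momentumPairing L a b γ X) (Icc a b) t) (Icc a b) ∧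
    ∫ t in a..b, (deriv (fun s => liftedVariation L a b γ F s t) 0 -
      derivWithin (momentumPairing L a b γ X) (Icc a b) t) =
        ∫ t in a..b, deriv (fun s => liftedVariation L a b γ F s t) 0 := by
  have h1 := continuousOn_deriv_liftedVariation hL hab hγ hF hid
  have hm := contDiffOn_momentumPairing hL hab hγ hF hid hX
  have h2 : ContinuousOn (derivWithin (momentumPairing L a b γ X) (Icc a b)) (Icc a b) :=
    hm.continuousOn_derivWithin (uniqueDiffOn_Icc hab) (by norm_num)
  refine ⟨h1.sub h2, ?_⟩
  rw [intervalIntegral.integral_sub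
    (ContinuousOn.intervalIntegrable (by rwa [uIcc_of_le hab.le]))
    (ContinuousOn.intervalIntegrable (by rwa [uIcc_of_le hab.le])),
    intervalIntegral.integral_derivWithin_Icc_of_contDiffOn_Icc hm hab.le,
    momentumPairing_eq_zero ha, momentumPairing_eq_zero hb]
  simp

theorem IsLocalFlow.contMDiffAt {ε : ℝ} {U : Set Q} (h : IsLocalFlow X ε U F) {q : Q}
    (hq : q ∈ U) : ContMDiffAt (𝓘(ℝ, ℝ).prod (𝓡 n)) (𝓡 n) 2 (uncurry F) (0, q) :=
  (h.smooth.contMDiffAt ((isOpen_Ioo.prod h.isOpen).mem_nhds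
    ⟨⟨neg_lt_zero.2 h.pos, h.pos⟩, hq⟩)).of_le (WithTop.coe_le_coe.2 (le_top : (2 : ℕ∞) ≤ ⊤))

theorem IsLocalFlow.eventually_zero {ε : ℝ} {U : Set Q} (h : IsLocalFlow X ε U F) {q : Q}
    (hq : q ∈ U) : ∀ᶠ q' in 𝓝 q, F 0 q' = q' :=
  Filter.mem_of_superset (h.isOpen.mem_nhds hq) h.zero

theorem IsLocalFlow.eventually_mfderiv {ε : ℝ} {U : Set Q} (h : IsLocalFlow X ε U F) {q : Q}
    (hq : q ∈ U) : ∀ᶠ q' in 𝓝 q,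
      (mfderiv 𝓘(ℝ, ℝ) (𝓡 n) (fun s => F s q') 0 (1 : ℝ) : 𝔼(n)) = X q' := by
  filter_upwards [h.isOpen.mem_nhds hq] with q' hq'
  have h0 : (0 : ℝ) ∈ Ioo (-ε) ε := ⟨neg_lt_zero.2 h.pos, h.pos⟩
  have h1 := (h.integral q' hq' 0 h0).hasMFDerivAt (Ioo_mem_nhds h0.1 h0.2)
  have h2 : (mfderiv 𝓘(ℝ, ℝ) (𝓡 n) (fun s => F s q') 0 (1 : ℝ) : 𝔼(n)) = X (F 0 q') := by
    rw [h1.mfderiv]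
    exact one_smul ℝ (X (F 0 q') : 𝔼(n))
  exact h2.trans (congrArg (fun q => (X q : 𝔼(n))) (h.zero q' hq'))

theorem isLocalExtreme_of_satisfiesLagrangeEquation
    (hL : ContMDiff (𝓡 n).tangent 𝓘(ℝ, ℝ) ∞ L)
    (hab : a < b) (hγ : ContMDiffOn 𝓘(ℝ, ℝ) (𝓡 n) 2 γ (Icc a b))
    (h : SatisfiesLagrangeEquation L a b γ) : IsLocalExtreme L a b γ := by
  intro X _ ha hb ε U F hflow hU
  have hmem : ∀ t ∈ Icc a b, γ t ∈ U := fun t ht => hU (mem_image_of_mem γ ht)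
  have hF := fun t ht => hflow.contMDiffAt (hmem t ht)
  have hid := fun t ht => hflow.eventually_zero (hmem t ht)
  have hX := fun t ht => hflow.eventually_mfderiv (hmem t ht)
  refine (hasDerivAt_action hL hab hγ hF hid).congr_deriv ?_
  rw [← (integral_deriv_liftedVariation hL hab hγ hF hid hX ha hb).2]
  refine (intervalIntegral.integral_congr fun t ht => ?_).trans intervalIntegral.integral_zero
  rw [uIcc_of_le hab.le] at ht
  have h1 := hasDerivAt_liftedVariation hL (IsManifold.chart_mem_maximalAtlas (γ t)) hab hγ ht
    (mem_chart_source _ _) (hF t ht) (hid t ht) (hX t ht)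
  have h2 := (satisfiesLagrangeEquation_iff hL hab hγ).1 h _
    (IsManifold.chart_mem_maximalAtlas (γ t)) t ht (mem_chart_source _ _)
  rw [h1.deriv, add_sub_cancel_right]
  exact h2 _

end FirstVariation

/-! ### Flows of localized vector fields -/

section LocalizedFlow

/-- A smooth vector field supported in a ball has a smooth flow for small times, which is the
identity where the field vanishes and preserves the ball. -/
theorem exists_smooth_flow_of_support_subset_ball {V : Type*} [NormedAddCommGroup V]
    [NormedSpace ℝ V] [FiniteDimensional ℝ V] {ξ : V → V} (hξ : ContDiff ℝ ∞ ξ) {x₀ : V} {r : ℝ}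
    (hsupp : ∀ y, y ∉ Metric.ball x₀ r → ξ y = 0) :
    ∃ ε > 0, ∃ f : ℝ → V → V, (∀ x, f 0 x = x) ∧
      (∀ x, ∀ s ∈ Ioo (-ε) ε, HasDerivAt (fun s => f s x) (ξ (f s x)) s) ∧
      ContDiffOn ℝ ∞ (uncurry f) (Ioo (-ε) ε ×ˢ univ) ∧
      (∀ x, ∀ s ∈ Ioo (-ε) ε, ξ x = 0 → f s x = x) ∧
      (∀ x, ∀ s ∈ Ioo (-ε) ε, x ∈ Metric.ball x₀ r → f s x ∈ Metric.ball x₀ r) := by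
  have hcs : HasCompactSupport ξ :=
    HasCompactSupport.intro (isCompact_closedBall x₀ r) fun y hy =>
      hsupp y fun h => hy (Metric.ball_subset_closedBall h)
  obtain ⟨κ, hκ⟩ := hξ.lipschitzWith_of_hasCompactSupport hcs (by simp)
  have : CompleteSpace V := FiniteDimensional.complete ℝ V
  obtain ⟨ε, hε, f, h0, hode, hsm⟩ := exists_smooth_flow hκ hξ
  have h00 : (0 : ℝ) ∈ Ioo (-ε) ε := ⟨neg_lt_zero.2 hε, hε⟩
  -- a solution that meets a zero of the field is constant
  have hstat : ∀ x y, ξ y = 0 → ∀ s₀ ∈ Ioo (-ε) ε, f s₀ x = y → ∀ s ∈ Ioo (-ε) ε, f s x = y := by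
    intro x y hy s₀ hs₀ hfy
    exact ODE_solution_unique_of_mem_Ioo (v := fun _ => ξ) (s := fun _ => univ) (K := κ)
      (fun _ _ => hκ.lipschitzOnWith) hs₀ (fun t ht => ⟨hode x t ht, mem_univ _⟩)
      (fun t _ => ⟨by simpa [hy] using hasDerivAt_const t y, mem_univ _⟩) hfy
  refine ⟨ε, hε, f, h0, hode, hsm, fun x s hs hx => hstat x x hx 0 h00 (h0 x) s hs, ?_⟩
  intro x s hs hx
  by_contra hcon
  have h1 := hstat x (f s x) (hsupp _ hcon) s hs rfl 0 h00
  rw [h0] at h1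
  exact hcon (h1 ▸ hx)

variable {n : ℕ} {Q : Type*} [TopologicalSpace Q] [ChartedSpace 𝔼(n) Q] [IsManifold (𝓡 n) ∞ Q]

/-- A vector field on the model space, supported in a ball whose closure lies in the image of a
chart, gives a smooth vector field on the manifold with a smooth flow for small times. Outside of
the chart the field is zero and the flow is the identity; these extensions are smooth because the
compact image of the closed ball is closed in a Hausdorff space. -/
theorem exists_vectorField_isLocalFlow [T2Space Q] {e : OpenPartialHomeomorph Q 𝔼(n)}
    (he : e ∈ IsManifold.maximalAtlas (𝓡 n) ∞ Q) {ξ : 𝔼(n) → 𝔼(n)} (hξ : ContDiff ℝ ∞ ξ)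
    {x₀ : 𝔼(n)} {r : ℝ} (hr : Metric.closedBall x₀ r ⊆ e.target)
    (hsupp : ∀ y, y ∉ Metric.ball x₀ r → ξ y = 0) :
    ∃ X : ∀ q : Q, TangentSpace (𝓡 n) q,
      ContMDiff (𝓡 n) (𝓡 n).tangent ∞ (fun q => (⟨q, X q⟩ : TangentBundle (𝓡 n) Q)) ∧
      (∀ q ∈ e.source, (mfderiv (𝓡 n) (𝓡 n) e q (X q) : 𝔼(n)) = ξ (e q)) ∧
      (∀ q, (q ∈ e.source → ξ (e q) = 0) → X q = 0) ∧
      ∃ ε F, IsLocalFlow X ε univ F := by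
  classical
  obtain ⟨ε, hε, f, h0, hode, hsm, hfix, hball⟩ :=
    exists_smooth_flow_of_support_subset_ball hξ hsupp
  let X : ∀ q : Q, TangentSpace (𝓡 n) q := fun q =>
    if q ∈ e.source then (mfderiv (𝓡 n) (𝓡 n) e.symm (e q) (ξ (e q)) : 𝔼(n)) else (0 : 𝔼(n))
  have hXin : ∀ q ∈ e.source, (X q : 𝔼(n)) = mfderiv (𝓡 n) (𝓡 n) e.symm (e q) (ξ (e q)) :=
    fun q hq => if_pos hq
  have hXzero : ∀ q, (q ∈ e.source → ξ (e q) = 0) → X q = 0 := by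
    intro q hq
    by_cases h : q ∈ e.source
    · refine (hXin q h).trans ?_
      rw [hq h]
      exact map_zero (mfderiv (𝓡 n) (𝓡 n) e.symm (e q) : 𝔼(n) →L[ℝ] 𝔼(n))
    · exact if_neg h
  let F : ℝ → Q → Q := fun s q => if q ∈ e.source then e.symm (f s (e q)) else q
  -- the compact set outside of which the field vanishes
  let C : Set Q := e.symm '' Metric.closedBall x₀ r
  have hC : IsClosed C := ((isCompact_closedBall x₀ r).image_of_continuousOn
    (e.continuousOn_symm.mono hr)).isClosed
  have hCsub : C ⊆ e.source := by
    rintro _ ⟨y, hy, rfl⟩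
    exact e.map_target (hr hy)
  have hout : ∀ q ∉ C, q ∈ e.source → ξ (e q) = 0 := fun q hq hqs => by
    refine hsupp _ fun h => hq ⟨e q, Metric.ball_subset_closedBall h, e.left_inv hqs⟩
  have htarget : ∀ s ∈ Ioo (-ε) ε, ∀ y ∈ e.target, f s y ∈ e.target := by
    intro s hs y hy
    by_cases h : y ∈ Metric.ball x₀ r
    · exact hr (Metric.ball_subset_closedBall (hball y s hs h))
    · rwa [hfix y s hs (hsupp y h)]
  have hFout : ∀ s ∈ Ioo (-ε) ε, ∀ q ∉ C, F s q = q := by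
    intro s hs q hq
    by_cases h : q ∈ e.source
    · simp only [F, if_pos h]
      rw [hfix _ s hs (hout q hq h), e.left_inv h]
    · simp only [F, if_neg h]
  refine ⟨X, ?_, ?_, hXzero, ε, F, hε, isOpen_univ, ?_, ?_, ?_⟩
  · intro q
    by_cases h : q ∈ e.source
    · have h1 : ContMDiffAt (𝓡 n) 𝓘(ℝ, 𝔼(n)) ∞ e q :=
        (contMDiffOn_of_mem_maximalAtlas he).contMDiffAt (e.open_source.mem_nhds h)
      have h2 : ContMDiffAt 𝓘(ℝ, 𝔼(n)) 𝓘(ℝ, 𝔼(n) × 𝔼(n)) ∞ (fun y => (y, ξ y)) (e q) :=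
        (contDiff_id.prodMk hξ).contDiffAt.contMDiffAt
      have h3 : ContMDiffAt 𝓘(ℝ, 𝔼(n) × 𝔼(n)) (𝓡 n).tangent ∞ (naturalParam e)
          (e q, ξ (e q)) := (contMDiffOn_naturalParam he).contMDiffAt
        ((e.open_target.prod isOpen_univ).mem_nhds ⟨e.map_source h, mem_univ _⟩)
      refine (ContMDiffAt.comp q (g := naturalParam e) (f := fun q => (e q, ξ (e q))) h3
        (ContMDiffAt.comp q (g := fun y => (y, ξ y)) h2 h1)).congr_of_eventuallyEq ?_
      filter_upwards [e.open_source.mem_nhds h] with q' hq'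
      exact mk_eq_naturalParam hq' (hXin q' hq').symm
    · have h1 := (Bundle.contMDiff_zeroSection (n := ∞) ℝ (F := 𝔼(n)) (IB := 𝓡 n)
        (TangentSpace (𝓡 n) (M := Q))) q
      refine ContMDiffAt.congr_of_eventuallyEq h1 ?_
      filter_upwards [hC.isOpen_compl.mem_nhds fun hq => h (hCsub hq)] with q' hq'
      rw [hXzero q' (hout q' hq')]
      rfl
  · intro q hq
    refine (congrArg (fun w : 𝔼(n) => (mfderiv (𝓡 n) (𝓡 n) e q w : 𝔼(n))) (hXin q hq)).trans ?_
    have h1 := mfderiv_mfderiv_symm_apply he (e.map_source hq) (ξ (e q))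
    rwa [e.left_inv hq] at h1
  · intro q _
    by_cases h : q ∈ e.source
    · simp only [F, if_pos h]
      rw [h0, e.left_inv h]
    · simp only [F, if_neg h]
  · intro q _ s hs
    refine HasMFDerivAt.hasMFDerivWithinAt ?_
    by_cases h : q ∈ e.source
    · have hft := htarget s hs (e q) (e.map_source h)
      have hFs : (fun s => F s q) = e.symm ∘ fun s => f s (e q) := by
        funext s
        simp only [F, if_pos h, comp]
      have h1 : HasMFDerivAt 𝓘(ℝ, ℝ) 𝓘(ℝ, 𝔼(n)) (fun s => f s (e q)) s
          ((1 : ℝ →L[ℝ] ℝ).smulRight (ξ (f s (e q)))) :=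
        (hode (e q) s hs).hasFDerivAt.hasMFDerivAt
      have h2 : MDifferentiableAt (𝓡 n) (𝓡 n) e.symm (f s (e q)) :=
        mdifferentiableAt_symm_of_mem_maximalAtlas (I := 𝓡 n) (mem_maximalAtlas_one he) hft
      have h3 := HasMFDerivAt.comp s (g := e.symm) (f := fun s => f s (e q)) h2.hasMFDerivAt h1
      have hFsrc : F s q = e.symm (f s (e q)) := if_pos h
      have hXF : (X (F s q) : 𝔼(n)) =
          mfderiv (𝓡 n) (𝓡 n) e.symm (f s (e q)) (ξ (f s (e q))) := by
        refine (congrArg (fun q => (X q : 𝔼(n))) hFsrc).trans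
          ((hXin _ (e.map_target hft)).trans ?_)
        rw [e.right_inv hft]
      rw [← hFs] at h3
      refine h3.congr_mfderiv ?_
      refine ContinuousLinearMap.ext_ring ?_
      let T : 𝔼(n) →L[ℝ] 𝔼(n) := mfderiv (𝓡 n) (𝓡 n) e.symm (f s (e q))
      change T ((1 : ℝ) • ξ (f s (e q))) = (1 : ℝ) • (X (F s q) : 𝔼(n))
      rw [one_smul, one_smul]
      exact hXF.symm
    · have hFs : (fun s => F s q) = fun _ => q := by
        funext s
        simp only [F, if_neg h]
      have hX0 : (X (F s q) : 𝔼(n)) = 0 :=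
        (congrArg (fun q => (X q : 𝔼(n))) (congrFun hFs s)).trans
          (hXzero q fun hq => absurd hq h)
      have h1 : HasMFDerivAt 𝓘(ℝ, ℝ) (𝓡 n) (fun s => F s q) s
          (0 : ℝ →L[ℝ] 𝔼(n)) := by
        rw [hFs]
        exact hasMFDerivAt_const q s
      refine h1.congr_mfderiv ?_
      refine ContinuousLinearMap.ext_ring ?_
      change (0 : 𝔼(n)) = (1 : ℝ) • (X (F s q) : 𝔼(n))
      rw [one_smul]
      exact hX0.symm
  · rintro ⟨s, q⟩ ⟨hs, -⟩
    refine ContMDiffAt.contMDiffWithinAt ?_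
    have hIoo : ∀ᶠ p : ℝ × Q in 𝓝 (s, q), p.1 ∈ Ioo (-ε) ε :=
      continuousAt_fst.eventually (isOpen_Ioo.mem_nhds hs)
    by_cases h : q ∈ e.source
    · have h1 : ContMDiffAt (𝓡 n) 𝓘(ℝ, 𝔼(n)) ∞ e q :=
        (contMDiffOn_of_mem_maximalAtlas he).contMDiffAt (e.open_source.mem_nhds h)
      have h2 : ContMDiffAt (𝓘(ℝ, ℝ).prod (𝓡 n)) 𝓘(ℝ, ℝ × 𝔼(n)) ∞
          (fun p : ℝ × Q => (p.1, e p.2)) (s, q) :=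
        contMDiffAt_fst.prodMk_space (ContMDiffAt.comp (s, q) (g := e) h1 contMDiffAt_snd)
      have h3 : ContMDiffAt 𝓘(ℝ, ℝ × 𝔼(n)) 𝓘(ℝ, 𝔼(n)) ∞ (uncurry f) (s, e q) :=
        (hsm.contDiffAt ((isOpen_Ioo.prod isOpen_univ).mem_nhds ⟨hs, mem_univ _⟩)).contMDiffAt
      have h4 : ContMDiffAt 𝓘(ℝ, 𝔼(n)) (𝓡 n) ∞ e.symm (f s (e q)) :=
        (contMDiffOn_symm_of_mem_maximalAtlas he).contMDiffAt
          (e.open_target.mem_nhds (htarget s hs _ (e.map_source h)))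
      have h5 := ContMDiffAt.comp (s, q) (g := e.symm) h4
        (ContMDiffAt.comp (s, q) (g := uncurry f) (f := fun p : ℝ × Q => (p.1, e p.2)) h3 h2)
      refine h5.congr_of_eventuallyEq ?_
      have hsrc : ∀ᶠ p : ℝ × Q in 𝓝 (s, q), p.2 ∈ e.source :=
        continuousAt_snd.eventually (e.open_source.mem_nhds h)
      filter_upwards [hsrc] with p hp
      simp only [uncurry, F, if_pos hp, comp]
    · refine (contMDiffAt_snd (I := 𝓘(ℝ, ℝ)) (M := ℝ)).congr_of_eventuallyEq ?_
      have hCout : ∀ᶠ p : ℝ × Q in 𝓝 (s, q), p.2 ∉ C :=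
        continuousAt_snd.eventually (hC.isOpen_compl.mem_nhds fun hq => h (hCsub hq))
      filter_upwards [hIoo, hCout] with p hp hp'
      exact hFout p.1 hp p.2 hp'

end LocalizedFlow

/-! ### The fundamental lemma of the calculus of variations -/

section ResidualLinearity

variable {V : Type*} [NormedAddCommGroup V] [NormedSpace ℝ V] {Λ : V × V → ℝ} {x : ℝ → V}

theorem eulerLagrangeResidual_smul (S : Set ℝ) (t c : ℝ) (w : V) :
    eulerLagrangeResidual Λ x S t (c • w) = c * eulerLagrangeResidual Λ x S t w := by
  have h1 : ∀ s, fderiv ℝ Λ (x s, derivWithin x S s) (0, c • w) =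
      c * fderiv ℝ Λ (x s, derivWithin x S s) (0, w) := fun s => by
    rw [← smul_eq_mul, ← map_smul]
    simp
  have h2 : fderiv ℝ Λ (x t, derivWithin x S t) (c • w, 0) =
      c * fderiv ℝ Λ (x t, derivWithin x S t) (w, 0) := by
    rw [← smul_eq_mul, ← map_smul]
    simp
  simp only [eulerLagrangeResidual, h1, h2, derivWithin_const_mul_field, mul_sub]

/-- The residual is continuous in time because the curve is `C²`. -/
theorem continuousWithinAt_eulerLagrangeResidual {a b t : ℝ} (hab : a < b) (ht : t ∈ Icc a b)
    (hx : ContDiffWithinAt ℝ 2 x (Icc a b) t)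
    (hΛ : ContDiffAt ℝ 2 Λ (x t, derivWithin x (Icc a b) t)) (w : V) :
    ContinuousWithinAt (fun s => eulerLagrangeResidual Λ x (Icc a b) s w) (Icc a b) t := by
  have h1 : ContinuousWithinAt (fun s => fderiv ℝ Λ (x s, derivWithin x (Icc a b) s))
      (Icc a b) t :=
    ContinuousAt.comp_continuousWithinAt (g := fderiv ℝ Λ)
      (hΛ.fderiv_right (m := 1) (by norm_num)).continuousAt
      (hx.continuousWithinAt.prodMk (contDiffWithinAt_velocity hab ht hx).continuousWithinAt)
  have h2 := ((contDiffWithinAt_momentum_field hab ht hx hΛ (ξ := fun _ => w)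
    contDiffAt_const).fderivWithin_right (m := 0) (uniqueDiffOn_Icc hab) (by norm_num)
    ht).continuousWithinAt
  exact (h1.clm_apply continuousWithinAt_const).sub (h2.clm_apply continuousWithinAt_const)

end ResidualLinearity

section FundamentalLemma

variable {n : ℕ} {Q : Type*} [TopologicalSpace Q] [ChartedSpace 𝔼(n) Q] [IsManifold (𝓡 n) ∞ Q]
  [T2Space Q] {L : TangentBundle (𝓡 n) Q → ℝ} {a b : ℝ} {γ : ℝ → Q}

/-- Simple times are found near every time, away from the end points. -/
theorem HasDenseSimpleTimes.exists_mem (hab : a < b) (hd : HasDenseSimpleTimes a b γ)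
    {t₀ : ℝ} (ht₀ : t₀ ∈ Icc a b) {O : Set ℝ} (hO : IsOpen O) (hmem : t₀ ∈ O) :
    ∃ t₁ ∈ O ∩ Ioo a b, ∀ s ∈ Icc a b, γ s = γ t₁ → s = t₁ := by
  rw [← closure_Ioo hab.ne] at ht₀
  obtain ⟨t', ht'O, ht'⟩ := mem_closure_iff.1 ht₀ O hO hmem
  obtain ⟨t₁, ht₁, ht₁S⟩ := mem_closure_iff.1 (hd (Ioo_subset_Icc_self ht')) (O ∩ Ioo a b)
    (hO.inter isOpen_Ioo) ⟨ht'O, ht'⟩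
  exact ⟨t₁, ht₁, ht₁S.2⟩

/-- If `γ` visits `γ t₁` only at the time `t₁`, then a small closed ball around that point in a
chart is visited only at times close to `t₁`, and not at the end points: the image of the other
times is compact and omits `γ t₁`. -/
theorem exists_closedBall_of_simple {e : OpenPartialHomeomorph Q 𝔼(n)}
    (hγ : ContinuousOn γ (Icc a b)) {O : Set ℝ} (hO : IsOpen O) {t₁ : ℝ}
    (ht₁ : t₁ ∈ O ∩ Ioo a b) (hsimple : ∀ s ∈ Icc a b, γ s = γ t₁ → s = t₁)
    (hs : γ t₁ ∈ e.source) :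
    ∃ r > 0, Metric.closedBall (e (γ t₁)) r ⊆ e.target ∧
      ∀ t ∈ Icc a b, γ t ∈ e.source → e (γ t) ∈ Metric.closedBall (e (γ t₁)) r →
        t ∈ O ∩ Ioo a b := by
  have hK : IsCompact (γ '' (Icc a b \ (O ∩ Ioo a b))) :=
    (isCompact_Icc.diff (hO.inter isOpen_Ioo)).image_of_continuousOn (hγ.mono sdiff_subset)
  have hnot : γ t₁ ∉ γ '' (Icc a b \ (O ∩ Ioo a b)) := by
    rintro ⟨s, hs', hsγ⟩
    exact hs'.2 (hsimple s hs'.1 hsγ ▸ ht₁)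
  have hsymm : ∀ᶠ y in 𝓝 (e (γ t₁)), e.symm y ∉ γ '' (Icc a b \ (O ∩ Ioo a b)) := by
    have hc := e.continuousAt_symm (e.map_source hs)
    refine hc.eventually (hK.isClosed.isOpen_compl.mem_nhds ?_)
    rwa [e.left_inv hs]
  obtain ⟨r, hr, hball⟩ := Metric.nhds_basis_closedBall.mem_iff.1
    (hsymm.and (e.open_target.mem_nhds (e.map_source hs)))
  refine ⟨r, hr, fun y hy => (hball hy).2, fun t ht htsrc hty => ?_⟩
  by_contra hcon
  have := (hball hty).1
  rw [e.left_inv htsrc] at this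
  exact this (mem_image_of_mem γ ⟨ht, hcon⟩)

/-- The fundamental lemma: along a local extreme with densely many simple times, the Euler–Lagrange
covector is nowhere positive on a fixed coordinate vector; otherwise a field supported near the
point of a simple time would make the action grow. Simplicity ensures that the field does not
meet the curve at other times, where the covector may have the opposite sign. -/
theorem eulerLagrangeResidual_nonpos_of_isLocalExtreme
    (hL : ContMDiff (𝓡 n).tangent 𝓘(ℝ, ℝ) ∞ L) (hab : a < b)
    (hγ : ContMDiffOn 𝓘(ℝ, ℝ) (𝓡 n) 2 γ (Icc a b)) (hd : HasDenseSimpleTimes a b γ)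
    (hext : IsLocalExtreme L a b γ) {e : OpenPartialHomeomorph Q 𝔼(n)}
    (he : e ∈ IsManifold.maximalAtlas (𝓡 n) ∞ Q) {t₀ : ℝ} (ht₀ : t₀ ∈ Icc a b)
    (hs₀ : γ t₀ ∈ e.source) (w : 𝔼(n)) :
    eulerLagrangeResidual (coordLagrangian L e) (fun s => e (γ s)) (Icc a b) t₀ w ≤ 0 := by
  by_contra! hpos
  set R : ℝ → 𝔼(n) → ℝ := eulerLagrangeResidual (coordLagrangian L e) (fun s => e (γ s)) (Icc a b)
  -- the residual stays positive near `t₀`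
  have hev : ∀ᶠ t in 𝓝[Icc a b] t₀, 0 < R t w ∧ γ t ∈ e.source :=
    ((continuousWithinAt_eulerLagrangeResidual hab ht₀ (contDiffWithinAt_chart_comp he hγ ht₀ hs₀)
      (contDiffAt_coordLagrangian_two hL he (e.map_source hs₀)) w).eventually
        (lt_mem_nhds hpos)).and
      ((hγ t₀ ht₀).continuousWithinAt.eventually (e.open_source.mem_nhds hs₀))
  obtain ⟨O, hO, ht₀O, hOsub⟩ := mem_nhdsWithin.1 hev
  obtain ⟨t₁, ht₁, hsimple⟩ := hd.exists_mem hab ht₀ hO ht₀O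
  have ht₁I : t₁ ∈ Icc a b := Ioo_subset_Icc_self ht₁.2
  have ht₁R := hOsub ⟨ht₁.1, ht₁I⟩
  obtain ⟨r, hr, hrt, hrO⟩ := exists_closedBall_of_simple hγ.continuousOn hO ht₁ hsimple ht₁R.2
  -- the field is a bump function times the constant field `w`
  let φ : ContDiffBump (e (γ t₁)) := ⟨r / 2, r, by positivity, by linarith⟩
  have hφ : ∀ y, y ∉ Metric.ball (e (γ t₁)) r → φ y = 0 := fun y hy => by
    rw [← notMem_support, φ.support_eq]
    exact hy
  obtain ⟨X, hXs, hXin, hX0, ε, F, hflow⟩ := exists_vectorField_isLocalFlow he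
    (ξ := fun y => φ y • w) (φ.contDiff.smul contDiff_const) hrt
    (fun y hy => by rw [hφ y hy, zero_smul])
  have hφO : ∀ t ∈ Icc a b, γ t ∈ e.source → φ (e (γ t)) ≠ 0 → t ∈ O ∩ Ioo a b := by
    intro t ht hts hne
    refine hrO t ht hts (Metric.ball_subset_closedBall ?_)
    by_contra hcon
    exact hne (hφ _ hcon)
  have hend : ∀ t ∈ Icc a b, t ∉ Ioo a b → X (γ t) = 0 := by
    intro t ht hnot
    refine hX0 _ fun hts => ?_
    by_contra hne
    exact hnot (hφO t ht hts fun h => hne (by rw [h, zero_smul])).2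
  have ha := hend a (left_mem_Icc.2 hab.le) (by simp)
  have hb := hend b (right_mem_Icc.2 hab.le) (by simp)
  have hF := fun t (_ : t ∈ Icc a b) => hflow.contMDiffAt (mem_univ (γ t))
  have hid := fun t (_ : t ∈ Icc a b) => hflow.eventually_zero (mem_univ (γ t))
  have hX := fun t (_ : t ∈ Icc a b) => hflow.eventually_mfderiv (mem_univ (γ t))
  obtain ⟨hcont, hint⟩ := integral_deriv_liftedVariation hL hab hγ hF hid hX ha hb
  have hzero := (hasDerivAt_action hL hab hγ hF hid).unique
    (hext X hXs ha hb ε univ F hflow (subset_univ _))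
  rw [← hint] at hzero
  -- the integrand is the bump function times the residual
  have hin : ∀ t ∈ Icc a b, γ t ∈ e.source →
      deriv (fun s => liftedVariation L a b γ F s t) 0 -
        derivWithin (momentumPairing L a b γ X) (Icc a b) t = φ (e (γ t)) * R t w := by
    intro t ht hts
    have h1 := hasDerivAt_liftedVariation hL he hab hγ ht hts (hF t ht) (hid t ht) (hX t ht)
    rw [h1.deriv, add_sub_cancel_right]
    refine (congrArg (R t) (hXin _ hts)).trans ?_
    exact eulerLagrangeResidual_smul _ _ _ _
  have hout : ∀ t ∈ Icc a b, γ t ∉ e.source →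
      deriv (fun s => liftedVariation L a b γ F s t) 0 -
        derivWithin (momentumPairing L a b γ X) (Icc a b) t = 0 := by
    intro t ht hts
    have h1 := hasDerivAt_liftedVariation hL (IsManifold.chart_mem_maximalAtlas (γ t)) hab hγ ht
      (mem_chart_source _ _) (hF t ht) (hid t ht) (hX t ht)
    rw [h1.deriv, add_sub_cancel_right, hX0 _ fun h => absurd h hts]
    have h2 := eulerLagrangeResidual_smul (Λ := coordLagrangian L (chartAt 𝔼(n) (γ t)))
      (x := fun s => chartAt 𝔼(n) (γ t) (γ s)) (Icc a b) t 0 0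
    rw [zero_smul, zero_mul] at h2
    exact (congrArg (eulerLagrangeResidual (coordLagrangian L (chartAt 𝔼(n) (γ t)))
      (fun s => chartAt 𝔼(n) (γ t) (γ s)) (Icc a b) t)
      (map_zero (mfderiv (𝓡 n) (𝓡 n) (chartAt 𝔼(n) (γ t)) (γ t) : 𝔼(n) →L[ℝ] 𝔼(n)))).trans h2
  refine (intervalIntegral.integral_pos hab hcont (fun t ht => ?_) ⟨t₁, ht₁I, ?_⟩).ne' hzero
  · have htI := Ioc_subset_Icc_self ht
    by_cases hts : γ t ∈ e.source
    · rw [hin t htI hts]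
      by_cases hne : φ (e (γ t)) = 0
      · rw [hne, zero_mul]
      · exact mul_nonneg φ.nonneg (hOsub ⟨(hφO t htI hts hne).1, htI⟩).1.le
    · rw [hout t htI hts]
  · rw [hin t₁ ht₁I ht₁R.2, φ.one_of_mem_closedBall (Metric.mem_closedBall_self φ.rIn_pos.le),
      one_mul]
    exact ht₁R.1

theorem satisfiesLagrangeEquation_of_isLocalExtreme
    (hL : ContMDiff (𝓡 n).tangent 𝓘(ℝ, ℝ) ∞ L) (hab : a < b)
    (hγ : ContMDiffOn 𝓘(ℝ, ℝ) (𝓡 n) 2 γ (Icc a b)) (hd : HasDenseSimpleTimes a b γ)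
    (hext : IsLocalExtreme L a b γ) : SatisfiesLagrangeEquation L a b γ := by
  refine (satisfiesLagrangeEquation_iff hL hab hγ).2 fun e he t ht hs w => ?_
  refine le_antisymm
    (eulerLagrangeResidual_nonpos_of_isLocalExtreme hL hab hγ hd hext he ht hs w) ?_
  have h := eulerLagrangeResidual_nonpos_of_isLocalExtreme hL hab hγ hd hext he ht hs
    ((-1 : ℝ) • w)
  rw [eulerLagrangeResidual_smul] at h
  linarith

end FundamentalLemma

end LagrangianMechanics

end

theorem mainTheorem3 {n : ℕ} {Q : Type*} [TopologicalSpace Q]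
    [ChartedSpace (EuclideanSpace ℝ (Fin n)) Q] [IsManifold (𝓡 n) ∞ Q]
    [T2Space Q] [SecondCountableTopology Q]
    (L : TangentBundle (𝓡 n) Q → ℝ) (hL : ContMDiff (𝓡 n).tangent 𝓘(ℝ, ℝ) ∞ L)
    (a b : ℝ) (hab : a < b) (γ : ℝ → Q) (hγ : ContMDiffOn 𝓘(ℝ, ℝ) (𝓡 n) 2 γ (Icc a b)) :
    (LagrangianMechanics.SatisfiesLagrangeEquation L a b γ ↔
      LagrangianMechanics.SatisfiesEulerLagrange L a b γ) ∧
    (LagrangianMechanics.SatisfiesLagrangeEquation L a b γ →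
      LagrangianMechanics.IsLocalExtreme L a b γ) ∧
    (LagrangianMechanics.HasDenseSimpleTimes a b γ →
      (LagrangianMechanics.IsLocalExtreme L a b γ ↔
        LagrangianMechanics.SatisfiesLagrangeEquation L a b γ)) := by
  refine ⟨?_, LagrangianMechanics.isLocalExtreme_of_satisfiesLagrangeEquation hL hab hγ,
    fun hd => ⟨LagrangianMechanics.satisfiesLagrangeEquation_of_isLocalExtreme hL hab hγ hd,
      LagrangianMechanics.isLocalExtreme_of_satisfiesLagrangeEquation hL hab hγ⟩⟩
  rw [LagrangianMechanics.satisfiesLagrangeEquation_iff hL hab hγ,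
    LagrangianMechanics.satisfiesEulerLagrange_iff hL hab hγ]
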